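/- Work over $\mathbb{C}$. A Lie conformal algebra is a $\mathbb{C}[\partial]$-module $\mathcal{R}$ with a $\lambda$-bracket $\mathcal{R}\otimes\mathcal{R}\to\mathbb{C}[\lambda]\otimes\mathcal{R}$, $a\otimes b\mapsto[a_\lambda b]$, satisfying $[\partial a_\lambda b]=-\lambda[a_\lambda b]$, $[a_\lambda\partial b]=(\partial+\lambda)[a_\lambda b]$, $[a_\lambda b]=-[b_{-\lambda-\partial}a]$ and $[a_\lambda[b_\mu c]]=[[a_\lambda b]_{\lambda+\mu}c]+[b_\mu[a_\lambda c]]$. An $\mathcal{R}$-module is a $\mathbb{C}[\partial]$-module $M$ with a bilinear map $a\otimes v\mapsto a_\lambda v\in M[\lambda]$ satisfying $a_\lambda(b_\mu v)-b_\mu(a_\lambda v)=[a_\lambda b]_{\lambda+\mu}v$, $(\partial a)_\lambda v=-\lambda a_\lambda v$ and $a_\lambda(\partial v)=(\partial+\lambda)a_\lambda v$. For $n\ge 0$ let $\tilde C^n(\mathcal{R},M)$ be the space of $n$-cochains, i.e. of $\mathbb{C}$-linear maps $\gamma:\mathcal{R}^{\otimes n}\to M[\lambda_1,\dots,\lambda_n]$,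 $a_1\otimes\cdots\otimes a_n\mapsto\gamma_{\lambda_1,\dots,\lambda_n}(a_1,\dots,a_n)$, with $\gamma_{\lambda_1,\dots,\lambda_n}(\dots,\partial a_i,\dots)=-\lambda_i\gamma_{\lambda_1,\dots,\lambda_n}(\dots,a_i,\dots)$ that are skew-symmetric under simultaneous permutations of the $a_i$ and the $\lambda_i$ (so $\tilde C^0(\mathcal{R},M)=M$). The differential is $$(d\gamma)_{\lambda_1,\dots,\lambda_{n+1}}(a_1,\dots,a_{n+1})=\sum_{i}(-1)^{i+1}a_{i\,\lambda_i}\gamma_{\lambda_1,\dots,\widehat{\lambda_i},\dots,\lambda_{n+1}}(a_1,\dots,\widehat{a_i},\dots,a_{n+1})$$ $$+\sum_{i<j}(-1)^{i+j}\gamma_{\lambda_i+\lambda_j,\lambda_1,\dots,\widehat{\lambda_i},\dots,\widehat{\lambda_j},\dots,\lambda_{n+1}}([a_{i\,\lambda_i}a_j],a_1,\dots,\widehat{a_i},\dots,\widehat{a_j},\dots,a_{n+1}).$$ The cohomology $\tilde H^\bullet(\mathcal{R},M)$ of $(\tilde C^\bullet(\mathcal{R},M),d)$ is the basic cohomology.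 The operator $\partial\gamma=(\partial_M+\sum_i\lambda_i)\gamma$ commutes with $d$, and the cohomology $H^\bullet(\mathcal{R},M)$ of the quotient complex $C^\bullet(\mathcal{R},M)=\tilde C^\bullet(\mathcal{R},M)/\partial\tilde C^\bullet(\mathcal{R},M)$ is the reduced cohomology. Let $\mathcal{B}$ be the Block type Lie conformal algebra: the free $\mathbb{C}[\partial]$-module with basis $\{J_i\mid i\in\mathbb{Z}_{\ge0}\}$ and $\lambda$-bracket determined by $[J_{i\,\lambda}J_j]=((i+1)\partial+(i+j+2)\lambda)J_{i+j}$. For $a\in\mathbb{C}$ let $\mathbb{C}_a$ be the one-dimensional $\mathcal{B}$-module $\mathbb{C}$ on which $\partial$ acts as the scalar $a$ and all elements of $\mathcal{B}$ act by zero; $\mathbb{C}=\mathbb{C}_0$ is the trivial module. For $\Delta,\alpha\in\mathbb{C}$ let $M_{\Delta,\alpha}=\mathbb{C}[\partial]v$ be the free $\mathbb{C}[\partial]$-module of rank one with $J_{0\,\lambda}v=(\partial+\alpha+\Delta\lambda)v$ and $J_{i\,\lambda}v=0$ for $i>0$. **Theorem.** 1. $\dim\tilde H^q(\mathcal{B},\mathbb{C})$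 is $1,0,0$ for $q=0,1,2$, and $\dim H^q(\mathcal{B},\mathbb{C})$ is $1,0,1$ for $q=0,1,2$. Moreover, $H^2(\mathcal{B},\mathbb{C})$ is spanned by the class of a cochain $\psi\in\tilde C^2(\mathcal{B},\mathbb{C})$ with $\psi_{\lambda,-\lambda}(J_0,J_0)=\lambda^3$ and $\psi_{\lambda,-\lambda}(J_i,J_j)=0$ for all $(i,j)\ne(0,0)$. 2. If $a\ne0$, then $\dim H^q(\mathcal{B},\mathbb{C}_a)=0$ for all $q\ge0$. 3. If $\alpha\ne0$, then $\dim H^q(\mathcal{B},M_{\Delta,\alpha})=0$ for all $\Delta\in\mathbb{C}$ and all $q\ge0$. -/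

import Mathlib

open Polynomial

noncomputable section

namespace LieConf

/-- A Lie conformal algebra structure on the complex vector space `R`. The operator `der` is the
action of `∂` (so `R` is a `ℂ[∂]`-module) and `bracket a b ∈ R[λ] = ℂ[λ] ⊗ R` is the `λ`-bracket
`[a_λ b]`. As `ℂ` is infinite, identities between polynomials in `λ, μ` with coefficients in `R`
are stated for all complex values `l, m` of `λ, μ`. -/
structure LieConformalAlgebra (R : Type*) [AddCommGroup R] [Module ℂ R] where
  /-- the operator `∂` -/
  der : R →ₗ[ℂ] R
  /-- the `λ`-bracket -/
  bracket : R →ₗ[ℂ] R →ₗ[ℂ] PolynomialModule ℂ R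
  /-- `[∂a_λ b] = -λ[a_λ b]` -/
  sesq_left : ∀ (a b : R) (l : ℂ),
    PolynomialModule.eval l (bracket (der a) b) = -(l • PolynomialModule.eval l (bracket a b))
  /-- `[a_λ ∂b] = (∂ + λ)[a_λ b]` -/
  sesq_right : ∀ (a b : R) (l : ℂ),
    PolynomialModule.eval l (bracket a (der b)) =
      der (PolynomialModule.eval l (bracket a b)) + l • PolynomialModule.eval l (bracket a b)
  /-- `[a_λ b] = -[b_{-λ-∂} a]`: if `[b_μ a] = ∑ μ ^ k c_k` then `[a_λ b] = -∑ (-λ-∂) ^ k c_k` -/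
  skew : ∀ (a b : R) (l : ℂ),
    PolynomialModule.eval l (bracket a b) =
      -((bracket b a).coeff.sum fun k c => ((-(l • (1 : Module.End ℂ R)) - der) ^ k) c)
  /-- `[a_λ [b_μ c]] = [[a_λ b]_{λ+μ} c] + [b_μ [a_λ c]]` -/
  jacobi : ∀ (a b c : R) (l m : ℂ),
    PolynomialModule.eval l (bracket a (PolynomialModule.eval m (bracket b c))) =
      PolynomialModule.eval (l + m) (bracket (PolynomialModule.eval l (bracket a b)) c) +
        PolynomialModule.eval m (bracket b (PolynomialModule.eval l (bracket a c)))

/-- A (conformal) module structure on the complex vector space `M` over the Lie conformal algebra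
`A`: `der` is the action of `∂` on `M` and `act a v ∈ M[λ]` is `a_λ v`. -/
structure ConformalModule {R : Type*} [AddCommGroup R] [Module ℂ R] (A : LieConformalAlgebra R)
    (M : Type*) [AddCommGroup M] [Module ℂ M] where
  /-- the operator `∂` on `M` -/
  der : M →ₗ[ℂ] M
  /-- the `λ`-action -/
  act : R →ₗ[ℂ] M →ₗ[ℂ] PolynomialModule ℂ M
  /-- `a_λ (b_μ v) - b_μ (a_λ v) = [a_λ b]_{λ+μ} v` -/
  act_bracket : ∀ (a b : R) (v : M) (l m : ℂ),
    PolynomialModule.eval l (act a (PolynomialModule.eval m (act b v))) -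
        PolynomialModule.eval m (act b (PolynomialModule.eval l (act a v))) =
      PolynomialModule.eval (l + m) (act (PolynomialModule.eval l (A.bracket a b)) v)
  /-- `(∂a)_λ v = -λ a_λ v` -/
  sesq_left : ∀ (a : R) (v : M) (l : ℂ),
    PolynomialModule.eval l (act (A.der a) v) = -(l • PolynomialModule.eval l (act a v))
  /-- `a_λ (∂v) = (∂ + λ) a_λ v` -/
  sesq_right : ∀ (a : R) (v : M) (l : ℂ),
    PolynomialModule.eval l (act a (der v)) =
      der (PolynomialModule.eval l (act a v)) + l • PolynomialModule.eval l (act a v)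

/-! ### The Block type Lie conformal algebra -/

/-- The free `ℂ[∂]`-module with basis `J_0, J_1, J_2, …`; the variable of `ℂ[X]` is `∂`. -/
abbrev Block : Type := ℕ →₀ ℂ[X]

/-- The basis element `J_i`. -/
def J (i : ℕ) : Block := Finsupp.single i 1

/-- The operator `∂` on `Block`. -/
def blockDer : Block →ₗ[ℂ] Block := (LinearMap.lsmul ℂ[X] Block X).restrictScalars ℂ

/-- For `f, g ∈ ℂ[∂]`, the coefficient
`f(-λ) g(∂+λ) ((i+1)∂ + (i+j+2)λ)` of `J_{i+j}` in `[f(∂)J_i _λ g(∂)J_j]`. It is an element of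
`ℂ[∂][λ]`: the outer variable `X` is `λ`, and `C X` is `∂`. -/
def blockCoeff (i j : ℕ) (f g : ℂ[X]) : ℂ[X][X] :=
  aeval (-X : ℂ[X][X]) f * aeval (C X + X : ℂ[X][X]) g *
    (((i : ℂ[X][X]) + 1) * C X + ((i : ℂ[X][X]) + (j : ℂ[X][X]) + 2) * X)

/-- `p ∈ ℂ[∂][λ]` is sent to `p J_k ∈ Block[λ]`. -/
def blockSingle (k : ℕ) : ℂ[X][X] →ₗ[ℂ] PolynomialModule ℂ Block :=
  (PolynomialModule.map ℂ (Finsupp.lsingle k : ℂ[X] →ₗ[ℂ] Block)) ∘ₗ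
    (PolynomialModule.equivPolynomial (R := ℂ) (S := ℂ[X])).symm.toLinearMap

theorem blockCoeff_add_left (i j : ℕ) (f f' g : ℂ[X]) :
    blockCoeff i j (f + f') g = blockCoeff i j f g + blockCoeff i j f' g := by
  simp [blockCoeff, add_mul]

theorem blockCoeff_add_right (i j : ℕ) (f g g' : ℂ[X]) :
    blockCoeff i j f (g + g') = blockCoeff i j f g + blockCoeff i j f g' := by
  simp only [blockCoeff, map_add]
  ring

theorem blockCoeff_smul_left (i j : ℕ) (c : ℂ) (f g : ℂ[X]) :
    blockCoeff i j (c • f) g = c • blockCoeff i j f g := by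
  simp [blockCoeff]

theorem blockCoeff_smul_right (i j : ℕ) (c : ℂ) (f g : ℂ[X]) :
    blockCoeff i j f (c • g) = c • blockCoeff i j f g := by
  simp [blockCoeff]

theorem blockCoeff_zero_left (i j : ℕ) (g : ℂ[X]) : blockCoeff i j 0 g = 0 := by
  simp [blockCoeff]

theorem blockCoeff_zero_right (i j : ℕ) (f : ℂ[X]) : blockCoeff i j f 0 = 0 := by
  simp [blockCoeff]

/-- The `λ`-bracket of `Block`: the `ℂ`-bilinear map with
`[f(∂)J_i _λ g(∂)J_j] = f(-λ) g(∂+λ) ((i+1)∂ + (i+j+2)λ) J_{i+j}`. -/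
def blockBracket : Block →ₗ[ℂ] Block →ₗ[ℂ] PolynomialModule ℂ Block :=
  LinearMap.mk₂ ℂ
    (fun a b => a.sum fun i f => b.sum fun j g => blockSingle (i + j) (blockCoeff i j f g))
    (fun a a' b => Finsupp.sum_add_index' (by simp [blockCoeff_zero_left])
      (by simp [blockCoeff_add_left]))
    (fun c a b => by
      rw [Finsupp.sum_smul_index' (by simp [blockCoeff_zero_left])]
      simp [blockCoeff_smul_left, Finsupp.smul_sum])
    (fun a b b' => by
      simp only [← Finsupp.sum_add]
      exact Finsupp.sum_congr fun i _ => Finsupp.sum_add_index' (by simp [blockCoeff_zero_right])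
        (by simp [blockCoeff_add_right]))
    (fun c a b => by
      rw [Finsupp.smul_sum]
      refine Finsupp.sum_congr fun i _ => ?_
      rw [Finsupp.sum_smul_index' (by simp [blockCoeff_zero_right])]
      simp [blockCoeff_smul_right, Finsupp.smul_sum])

theorem blockBracket_single (i j : ℕ) (f g : ℂ[X]) :
    blockBracket (Finsupp.single i f) (Finsupp.single j g) =
      blockSingle (i + j) (blockCoeff i j f g) := by
  simp [blockBracket, blockCoeff_zero_left, blockCoeff_zero_right]

theorem eval_blockSingle (k : ℕ) (p : ℂ[X][X]) (l : ℂ) :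
    PolynomialModule.eval l (blockSingle k p) = Finsupp.single k (p.eval (C l)) := by
  induction p using Polynomial.induction_on' with
  | add p q hp hq => simp [hp, hq]
  | monomial n q =>
    simp only [blockSingle, LinearMap.comp_apply, LinearEquiv.coe_coe,
      PolynomialModule.equivPolynomial_symm_monomial, PolynomialModule.map_single,
      PolynomialModule.eval_single, Polynomial.eval_monomial, Finsupp.lsingle_apply]
    rw [← C_pow, mul_comm, ← smul_eq_C_mul, Finsupp.smul_single]

theorem blockDer_single (i : ℕ) (f : ℂ[X]) :
    blockDer (Finsupp.single i f) = Finsupp.single i (X * f) := by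
  simp [blockDer]

theorem subst_add (T : Module.End ℂ Block) (p q : PolynomialModule ℂ Block) :
    ((p + q).coeff.sum fun k c => (T ^ k) c) =
      (p.coeff.sum fun k c => (T ^ k) c) + (q.coeff.sum fun k c => (T ^ k) c) := by
  rw [PolynomialModule.coeff_add]
  exact Finsupp.sum_add_index' (by simp) (by simp)

theorem subst_blockSingle (k : ℕ) (p : ℂ[X][X]) (l : ℂ) :
    ((blockSingle k p).coeff.sum fun n c => ((-(l • (1 : Module.End ℂ Block)) - blockDer) ^ n) c) =
      Finsupp.single k (p.eval (-C l - X)) := by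
  induction p using Polynomial.induction_on' with
  | add p q hp hq => rw [map_add, subst_add, hp, hq]; simp
  | monomial n q =>
    simp only [blockSingle, LinearMap.comp_apply, LinearEquiv.coe_coe,
      PolynomialModule.equivPolynomial_symm_monomial, PolynomialModule.map_single,
      PolynomialModule.coeff_single, Polynomial.eval_monomial, Finsupp.lsingle_apply]
    rw [Finsupp.sum_single_index (by simp)]
    induction n generalizing q with
    | zero => simp
    | succ n ih =>
      rw [pow_succ, Module.End.mul_apply]
      have : (-(l • (1 : Module.End ℂ Block)) - blockDer) (Finsupp.single k q) =
          Finsupp.single k ((-C l - X) * q) := by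
        simp [blockDer_single, sub_mul, smul_eq_C_mul]
      rw [this, ih]
      congr 1
      ring

theorem eval_aeval_neg (f : ℂ[X]) (l : ℂ) :
    Polynomial.eval (C l) (aeval (-X : ℂ[X][X]) f) = C (f.eval (-l)) := by
  induction f using Polynomial.induction_on' with
  | add p q hp hq => simp [hp, hq]
  | monomial n q => simp [aeval_monomial, Polynomial.algebraMap_apply]

theorem eval_aeval_add (f : ℂ[X]) (l : ℂ) :
    Polynomial.eval (C l) (aeval (C X + X : ℂ[X][X]) f) = f.comp (X + C l) := by
  induction f using Polynomial.induction_on' with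
  | add p q hp hq => simp [hp, hq]
  | monomial n q => simp [aeval_monomial, Polynomial.algebraMap_apply]

theorem eval_blockBracket_single (i j : ℕ) (f g : ℂ[X]) (l : ℂ) :
    PolynomialModule.eval l (blockBracket (Finsupp.single i f) (Finsupp.single j g)) =
      Finsupp.single (i + j) (C (f.eval (-l)) * g.comp (X + C l) *
        (((i : ℂ[X]) + 1) * X + ((i : ℂ[X]) + (j : ℂ[X]) + 2) * C l)) := by
  rw [blockBracket_single, eval_blockSingle]
  congr 1
  simp [blockCoeff, eval_aeval_neg, eval_aeval_add]

theorem eval_blockBracket_zero (a b : Block) (l : ℂ) :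
    (PolynomialModule.eval l (blockBracket a b)) 0 =
      C ((a 0).eval (-l)) * (b 0).comp (X + C l) * (X + 2 * C l) := by
  induction a using Finsupp.induction_linear with
  | zero => simp
  | add a a' ha ha' => simp only [map_add, LinearMap.add_apply, Finsupp.add_apply, ha, ha',
      eval_add, add_mul]
  | single i f =>
    induction b using Finsupp.induction_linear with
    | zero => simp
    | add b b' hb hb' => simp only [map_add, Finsupp.add_apply, hb, hb', add_comp]; ring
    | single j g =>
      rw [eval_blockBracket_single]
      rcases i with _ | i <;> rcases j with _ | j <;> simp

/-- The Lie conformal algebra `𝓑` of Block type: the free `ℂ[∂]`-module on `J_i`, `i ∈ ℕ`, with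
`[J_i _λ J_j] = ((i+1)∂ + (i+j+2)λ) J_{i+j}`. -/
def blockB : LieConformalAlgebra Block where
  der := blockDer
  bracket := blockBracket
  sesq_left a b l := by
    induction a using Finsupp.induction_linear with
    | zero => simp
    | add a a' ha ha' => simp only [map_add, LinearMap.add_apply, ha, ha', smul_add]; abel
    | single i f =>
      induction b using Finsupp.induction_linear with
      | zero => simp
      | add b b' hb hb' => simp only [map_add, hb, hb', smul_add]; abel
      | single j g =>
        rw [blockDer_single, eval_blockBracket_single, eval_blockBracket_single,
          Finsupp.smul_single, ← Finsupp.single_neg]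
        congr 1
        simp [smul_eq_C_mul]
        ring
  sesq_right a b l := by
    induction a using Finsupp.induction_linear with
    | zero => simp
    | add a a' ha ha' => simp only [map_add, LinearMap.add_apply, ha, ha', smul_add]; abel
    | single i f =>
      induction b using Finsupp.induction_linear with
      | zero => simp
      | add b b' hb hb' => simp only [map_add, hb, hb', smul_add]; abel
      | single j g =>
        rw [blockDer_single, eval_blockBracket_single, eval_blockBracket_single,
          Finsupp.smul_single, blockDer_single, ← Finsupp.single_add]
        congr 1
        simp [smul_eq_C_mul]
        ring
  skew a b l := by
    induction a using Finsupp.induction_linear with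
    | zero => simp
    | add a a' ha ha' =>
      simp only [map_add, LinearMap.add_apply, ha, ha', subst_add]; abel
    | single i f =>
      induction b using Finsupp.induction_linear with
      | zero => simp
      | add b b' hb hb' => simp only [map_add, LinearMap.add_apply, hb, hb', subst_add]; abel
      | single j g =>
        rw [eval_blockBracket_single, blockBracket_single, subst_blockSingle, add_comm j i,
          ← Finsupp.single_neg]
        congr 1
        have h1 : ∀ f : ℂ[X],
            Polynomial.eval (-C l - X) (aeval (-X : ℂ[X][X]) f) = f.comp (X + C l) := by
          intro f
          induction f using Polynomial.induction_on' with
          | add p q hp hq => simp [hp, hq]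
          | monomial n q =>
            simp [aeval_monomial, Polynomial.algebraMap_apply]
        have h2 : ∀ g : ℂ[X],
            Polynomial.eval (-C l - X) (aeval (C X + X : ℂ[X][X]) g) = C (g.eval (-l)) := by
          intro f
          induction f using Polynomial.induction_on' with
          | add p q hp hq => simp [hp, hq]
          | monomial n q => simp [aeval_monomial, Polynomial.algebraMap_apply]
        simp [blockCoeff, h1, h2]
        ring
  jacobi a b c l m := by
    induction a using Finsupp.induction_linear with
    | zero => simp
    | add a a' ha ha' => simp only [map_add, LinearMap.add_apply, ha, ha']; abel
    | single i f =>
      induction b using Finsupp.induction_linear with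
      | zero => simp
      | add b b' hb hb' => simp only [map_add, LinearMap.add_apply, hb, hb']; abel
      | single j g =>
        induction c using Finsupp.induction_linear with
        | zero => simp
        | add c c' hc hc' => simp only [map_add, hc, hc']; abel
        | single k h =>
          simp only [eval_blockBracket_single]
          rw [show j + (i + k) = i + (j + k) by ring, add_assoc i j k, ← Finsupp.single_add]
          congr 1
          have e2 : (C 2 : ℂ[X]) = 2 := map_ofNat C 2
          simp [Polynomial.comp_assoc, e2]
          ring_nf

/-- On the basis, the bracket is `[J_i _λ J_j] = ((i+1)∂ + (i+j+2)λ) J_{i+j}`. -/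
theorem blockB_bracket_J (i j : ℕ) (l : ℂ) :
    PolynomialModule.eval l (blockB.bracket (J i) (J j)) =
      ((i : ℂ) + 1) • blockB.der (J (i + j)) + (((i : ℂ) + j + 2) * l) • J (i + j) := by
  simp only [blockB, J, eval_blockBracket_single, blockDer_single, Finsupp.smul_single,
    ← Finsupp.single_add]
  congr 1
  have e2 : (C 2 : ℂ[X]) = 2 := map_ofNat C 2
  simp [smul_eq_C_mul, e2]

/-! ### Modules -/

/-- The one-dimensional module `ℂ_a` over a Lie conformal algebra: `∂` acts on `ℂ` as the scalar
`a`, and all elements of the algebra act by zero. For `a = 0` this is the trivial module `ℂ`. -/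
def scalarModule {R : Type*} [AddCommGroup R] [Module ℂ R] (A : LieConformalAlgebra R) (a : ℂ) :
    ConformalModule A ℂ where
  der := a • LinearMap.id
  act := 0
  act_bracket := by simp
  sesq_left := by simp
  sesq_right := by simp

/-- The trivial module `ℂ`. -/
abbrev trivialModule {R : Type*} [AddCommGroup R] [Module ℂ R] (A : LieConformalAlgebra R) :
    ConformalModule A ℂ := scalarModule A 0

theorem eval_equivPolynomial_symm (p : ℂ[X][X]) (l : ℂ) :
    PolynomialModule.eval l ((PolynomialModule.equivPolynomial (R := ℂ) (S := ℂ[X])).symm p) =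
      p.eval (C l) := by
  induction p using Polynomial.induction_on' with
  | add p q hp hq => simp [hp, hq]
  | monomial n q =>
    simp only [PolynomialModule.equivPolynomial_symm_monomial,
      PolynomialModule.eval_single, Polynomial.eval_monomial]
    rw [← C_pow, mul_comm, ← smul_eq_C_mul]

/-- The `λ`-action of `Block` on `M_{Δ,α} = ℂ[∂]v`:
`(∑ f_i(∂)J_i) _λ g(∂)v = f_0(-λ) g(∂+λ) (∂ + α + Δλ) v`, as an element of `ℂ[∂][λ]`. -/
def rankOneAct (Δ α : ℂ) : Block →ₗ[ℂ] ℂ[X] →ₗ[ℂ] PolynomialModule ℂ ℂ[X] :=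
  LinearMap.mk₂ ℂ
    (fun a g => (PolynomialModule.equivPolynomial (R := ℂ) (S := ℂ[X])).symm
      (aeval (-X : ℂ[X][X]) (a 0) * aeval (C X + X : ℂ[X][X]) g * (C (X + C α) + C (C Δ) * X)))
    (fun a a' g => by simp [add_mul])
    (fun c a g => by simp)
    (fun a g g' => by rw [← map_add]; congr 1; simp only [map_add]; ring)
    (fun c a g => by simp)

theorem eval_rankOneAct (Δ α : ℂ) (a : Block) (g : ℂ[X]) (l : ℂ) :
    PolynomialModule.eval l (rankOneAct Δ α a g) =
      C ((a 0).eval (-l)) * g.comp (X + C l) * (X + C α + C Δ * C l) := by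
  rw [rankOneAct, LinearMap.mk₂_apply, eval_equivPolynomial_symm]
  simp [eval_aeval_neg, eval_aeval_add]

/-- The module `M_{Δ,α} = ℂ[∂]v` over `𝓑`, with
`J_0 _λ v = (∂ + α + Δλ)v` and `J_i _λ v = 0` for `i > 0`. -/
def rankOneModule (Δ α : ℂ) : ConformalModule blockB ℂ[X] where
  der := LinearMap.mulLeft ℂ X
  act := rankOneAct Δ α
  act_bracket a b g l m := by
    simp only [eval_rankOneAct, blockB, eval_blockBracket_zero]
    have e2 : (C 2 : ℂ[X]) = 2 := map_ofNat C 2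
    simp [Polynomial.comp_assoc, e2]
    ring_nf
  sesq_left a g l := by
    have : (blockB.der a) 0 = X * a 0 := rfl
    simp [eval_rankOneAct, this, smul_eq_C_mul]
    ring
  sesq_right a g l := by
    simp [eval_rankOneAct, smul_eq_C_mul]
    ring

theorem rankOneModule_act_J (Δ α l : ℂ) (i : ℕ) :
    PolynomialModule.eval l ((rankOneModule Δ α).act (J i) 1) =
      if i = 0 then X + C α + C Δ * C l else 0 := by
  simp only [rankOneModule, eval_rankOneAct, J]
  split_ifs with h <;> simp [h]

/-! ### Cochains -/

section Cochains

variable {R : Type*} [AddCommGroup R] [Module ℂ R] {A : LieConformalAlgebra R}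
variable {M : Type*} [AddCommGroup M] [Module ℂ M]

/-- The space `M[λ_1,…,λ_n] = ℂ[λ_1,…,λ_n] ⊗ M` of polynomials with coefficients in `M`. Since `ℂ`
is infinite such a polynomial is the same thing as a polynomial function `ℂⁿ → M`, and it is
represented by that function: this is the span of the functions `x ↦ p(x) v` with
`p ∈ ℂ[λ_1,…,λ_n]` and `v ∈ M`. -/
def polyFun (n : ℕ) (M : Type*) [AddCommGroup M] [Module ℂ M] :
    Submodule ℂ ((Fin n → ℂ) → M) :=
  Submodule.span ℂ
    {f | ∃ (p : MvPolynomial (Fin n) ℂ) (v : M), f = fun x => MvPolynomial.eval x p • v}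

/-- The defining properties of an `n`-cochain `γ` with coefficients in the module `V`, where
`γ x a = γ_{λ_1,…,λ_n}(a_1,…,a_n)` at `λ_i = x_i`. -/
structure IsCochain (V : ConformalModule A M) {n : ℕ}
    (γ : (Fin n → ℂ) → (Fin n → R) → M) : Prop where
  /-- `γ` is `ℂ`-linear on `R ⊗ ⋯ ⊗ R` -/
  multilinear : ∀ x, ∃ f : MultilinearMap ℂ (fun _ : Fin n => R) M, ∀ a, f a = γ x a
  /-- `γ` has values in `M[λ_1,…,λ_n]` -/
  polynomial : ∀ a, (fun x => γ x a) ∈ polyFun n M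
  /-- conformal antilinearity -/
  antilinear : ∀ x a i, γ x (Function.update a i (A.der (a i))) = -(x i • γ x a)
  /-- skew-symmetry under simultaneous permutations of the `a_i` and the `λ_i` -/
  skew : ∀ x a (σ : Equiv.Perm (Fin n)),
    γ (x ∘ σ) (a ∘ σ) = ((Equiv.Perm.sign σ : ℤ) : ℂ) • γ x a

/-- The part `∑ (-1)^{i+1} a_i _{λ_i} γ(…, â_i, …)` of the differential
(indices in `Fin (n + 1)` start at `0`, whence the exponent `i`). -/
def dAct (V : ConformalModule A M) {n : ℕ} (γ : (Fin n → ℂ) → (Fin n → R) → M)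
    (x : Fin (n + 1) → ℂ) (a : Fin (n + 1) → R) : M :=
  ∑ i : Fin (n + 1), (-1 : ℂ) ^ (i : ℕ) •
    PolynomialModule.eval (x i) (V.act (a i) (γ (i.removeNth x) (i.removeNth a)))

/-- The part `∑_{i<j} (-1)^{i+j} γ_{λ_i+λ_j, …}([a_i _{λ_i} a_j], …, â_i, …, â_j, …)` of the
differential. The pairs of indices `i < j` in `Fin (n + 2)` are written as
`i.castSucc < j.succ` with `i ≤ j` in `Fin (n + 1)`; counted from `1` these are the indices
`i + 1` and `j + 2`. There are no such pairs for a `0`-cochain. -/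
def dBracket (A : LieConformalAlgebra R) : {n : ℕ} → ((Fin n → ℂ) → (Fin n → R) → M) →
    (Fin (n + 1) → ℂ) → (Fin (n + 1) → R) → M
  | 0, _ => fun _ _ => 0
  | n + 1, γ => fun x a =>
    ∑ i : Fin (n + 1), ∑ j ≥ i, (-1 : ℂ) ^ ((i : ℕ) + 1 + (j + 2)) •
      γ (Fin.cons (x i.castSucc + x j.succ) (j.removeNth (i.castSucc.removeNth x)))
        (Fin.cons (PolynomialModule.eval (x i.castSucc) (A.bracket (a i.castSucc) (a j.succ)))
          (j.removeNth (i.castSucc.removeNth a)))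

/-- The differential `dγ`. -/
def dFun (V : ConformalModule A M) {n : ℕ} (γ : (Fin n → ℂ) → (Fin n → R) → M)
    (x : Fin (n + 1) → ℂ) (a : Fin (n + 1) → R) : M :=
  dAct V γ x a + dBracket A γ x a

/-- The action of `∂` on cochains, `(∂γ)_λ(a) = (∂_M + ∑ λ_i) γ_λ(a)`. -/
def derFun (V : ConformalModule A M) {n : ℕ} (γ : (Fin n → ℂ) → (Fin n → R) → M)
    (x : Fin n → ℂ) (a : Fin n → R) : M :=
  V.der (γ x a) + (∑ i, x i) • γ x a

/-! The differential and `∂` preserve cochains and commute. -/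

theorem polyFun_zero {n : ℕ} : (fun _ => 0) ∈ polyFun n M := Submodule.zero_mem _

theorem polyFun_add {n : ℕ} {f g : (Fin n → ℂ) → M} (hf : f ∈ polyFun n M)
    (hg : g ∈ polyFun n M) : (fun x => f x + g x) ∈ polyFun n M := Submodule.add_mem _ hf hg

theorem polyFun_smul {n : ℕ} (c : ℂ) {f : (Fin n → ℂ) → M} (hf : f ∈ polyFun n M) :
    (fun x => c • f x) ∈ polyFun n M := Submodule.smul_mem _ c hf

theorem polyFun_comp {n m : ℕ} (q : Fin n → MvPolynomial (Fin m) ℂ) {f : (Fin n → ℂ) → M}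
    (hf : f ∈ polyFun n M) : (fun x => f fun i => MvPolynomial.eval x (q i)) ∈ polyFun m M := by
  induction hf using Submodule.span_induction with
  | mem f hf =>
    obtain ⟨p, v, rfl⟩ := hf
    refine Submodule.subset_span ⟨MvPolynomial.bind₁ q p, v, ?_⟩
    funext x
    exact congrArg (· • v) (MvPolynomial.eval₂Hom_bind₁ (RingHom.id ℂ) x q p).symm
  | zero => exact Submodule.zero_mem _
  | add f g _ _ hf hg => exact Submodule.add_mem _ hf hg
  | smul c f _ hf => exact Submodule.smul_mem _ c hf

theorem polyFun_mul {n : ℕ} (q : MvPolynomial (Fin n) ℂ) {f : (Fin n → ℂ) → M}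
    (hf : f ∈ polyFun n M) : (fun x => MvPolynomial.eval x q • f x) ∈ polyFun n M := by
  induction hf using Submodule.span_induction with
  | mem f hf =>
    obtain ⟨p, v, rfl⟩ := hf
    refine Submodule.subset_span ⟨q * p, v, ?_⟩
    funext x
    simp [mul_smul]
  | zero => simpa using polyFun_zero
  | add f g _ _ hf hg => simpa [smul_add] using polyFun_add hf hg
  | smul c f _ hf => simpa [smul_comm _ c] using polyFun_smul c hf

theorem polyFun_map {n : ℕ} (T : M →ₗ[ℂ] M) {f : (Fin n → ℂ) → M}
    (hf : f ∈ polyFun n M) : (fun x => T (f x)) ∈ polyFun n M := by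
  induction hf using Submodule.span_induction with
  | mem f hf =>
    obtain ⟨p, v, rfl⟩ := hf
    exact Submodule.subset_span ⟨p, T v, by simp⟩
  | zero => simpa using polyFun_zero
  | add f g _ _ hf hg => simpa using polyFun_add hf hg
  | smul c f _ hf => simpa using polyFun_smul c hf

/-- The part of `IsCochain` without skew-symmetry. -/
structure IsPre (A : LieConformalAlgebra R) {n : ℕ}
    (γ : (Fin n → ℂ) → (Fin n → R) → M) : Prop where
  multilinear : ∀ x, ∃ f : MultilinearMap ℂ (fun _ : Fin n => R) M, ∀ a, f a = γ x a
  polynomial : ∀ a, (fun x => γ x a) ∈ polyFun n M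
  antilinear : ∀ x a i, γ x (Function.update a i (A.der (a i))) = -(x i • γ x a)

theorem IsCochain.isPre {V : ConformalModule A M} {n : ℕ} {γ : (Fin n → ℂ) → (Fin n → R) → M}
    (h : IsCochain V γ) : IsPre A γ := ⟨h.multilinear, h.polynomial, h.antilinear⟩

theorem IsPre.zero {n : ℕ} :
    IsPre A (fun _ _ => 0 : (Fin n → ℂ) → (Fin n → R) → M) :=
  ⟨fun _ => ⟨0, fun _ => rfl⟩, fun _ => Submodule.zero_mem _, by simp⟩

theorem IsPre.add {n : ℕ} {γ δ : (Fin n → ℂ) → (Fin n → R) → M} (h : IsPre A γ)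
    (k : IsPre A δ) : IsPre A (fun x a => γ x a + δ x a) := by
  refine ⟨fun x => ?_, fun a => ?_, fun x a i => ?_⟩
  · obtain ⟨f, hf⟩ := h.multilinear x
    obtain ⟨g, hg⟩ := k.multilinear x
    exact ⟨f + g, fun a => by simp [hf, hg]⟩
  · exact Submodule.add_mem _ (h.polynomial a) (k.polynomial a)
  · rw [h.antilinear, k.antilinear, smul_add]; abel

theorem IsPre.smul {n : ℕ} (c : ℂ) {γ : (Fin n → ℂ) → (Fin n → R) → M} (h : IsPre A γ) :
    IsPre A (fun x a => c • γ x a) := by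
  refine ⟨fun x => ?_, fun a => ?_, fun x a i => ?_⟩
  · obtain ⟨f, hf⟩ := h.multilinear x
    exact ⟨c • f, fun a => by simp [hf]⟩
  · exact Submodule.smul_mem _ c (h.polynomial a)
  · rw [h.antilinear, smul_neg, smul_comm]

theorem IsPre.sum {n : ℕ} {ι : Type*} (s : Finset ι) {γ : ι → (Fin n → ℂ) → (Fin n → R) → M}
    (h : ∀ i, IsPre A (γ i)) : IsPre A (fun x a => ∑ i ∈ s, γ i x a) := by
  classical
  induction s using Finset.induction_on with
  | empty => simpa using IsPre.zero
  | insert i s hi ih => simpa [Finset.sum_insert hi] using (h i).add ih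

theorem IsPre.perm {n : ℕ} (σ : Equiv.Perm (Fin n)) {γ : (Fin n → ℂ) → (Fin n → R) → M}
    (h : IsPre A γ) : IsPre A (fun x a => γ (x ∘ σ) (a ∘ σ)) := by
  refine ⟨fun x => ?_, fun a => ?_, fun x a i => ?_⟩
  · obtain ⟨f, hf⟩ := h.multilinear (x ∘ σ)
    exact ⟨f.domDomCongr σ, fun a => by
      rw [← hf]; rfl⟩
  · have := polyFun_comp (fun i => MvPolynomial.X (σ i)) (h.polynomial (a ∘ σ))
    simpa [Function.comp_def] using this
  · have := h.antilinear (x ∘ σ) (a ∘ σ) (σ.symm i)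
    rw [← Function.update_comp_equiv] at this
    simpa using this

theorem comp_cycleRange_symm {n : ℕ} {α : Type*} (i : Fin (n + 1)) (a : Fin (n + 1) → α) :
    a ∘ i.cycleRange.symm = Fin.cons (a i) (i.removeNth a) := by
  funext k
  refine Fin.cases ?_ (fun k => ?_) k <;> simp [Fin.removeNth]

/-- Alternation of a function which is already skew-symmetric in all but the first argument. -/
def alt {n : ℕ} (K : (Fin (n + 1) → ℂ) → (Fin (n + 1) → R) → M)
    (x : Fin (n + 1) → ℂ) (a : Fin (n + 1) → R) : M :=
  ∑ i : Fin (n + 1), (-1 : ℂ) ^ (i : ℕ) •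
    K (Fin.cons (x i) (i.removeNth x)) (Fin.cons (a i) (i.removeNth a))

theorem IsPre.alt {n : ℕ} {K : (Fin (n + 1) → ℂ) → (Fin (n + 1) → R) → M} (h : IsPre A K) :
    IsPre A (alt K) := by
  refine IsPre.sum _ fun i => IsPre.smul _ ?_
  simpa only [comp_cycleRange_symm] using h.perm i.cycleRange.symm

theorem exists_tail_perm {n : ℕ} (h : Equiv.Perm (Fin (n + 1))) (h0 : h 0 = 0) :
    ∃ e : Equiv.Perm (Fin n), (∀ k, h k.succ = (e k).succ) ∧
      Equiv.Perm.sign h = Equiv.Perm.sign e := by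
  obtain ⟨⟨p, e⟩, rfl⟩ := Equiv.Perm.decomposeFin.symm.surjective h
  have hp : p = 0 := by simpa using h0
  subst hp
  exact ⟨e, fun k => by simp [Equiv.Perm.decomposeFin_symm_apply_succ], by simp⟩

theorem comp_eq_cons {n : ℕ} {α : Type*} (h : Equiv.Perm (Fin (n + 1))) (h0 : h 0 = 0)
    (e : Equiv.Perm (Fin n)) (he : ∀ k, h k.succ = (e k).succ) (a : Fin (n + 1) → α) :
    a ∘ h = Fin.cons (a 0) (Fin.tail a ∘ e) := by
  funext k
  refine Fin.cases ?_ (fun k => ?_) k <;> simp [h0, he, Fin.tail]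

theorem cons_comp_perm {n : ℕ} {α : Type*} (e : Equiv.Perm (Fin n)) (u : α) (a : Fin n → α) :
    (Fin.cons u (a ∘ e) : Fin (n + 1) → α) =
      Fin.cons u a ∘ Equiv.Perm.decomposeFin.symm (0, e) := by
  funext k
  refine Fin.cases ?_ (fun k => ?_) k <;> simp [Equiv.Perm.decomposeFin_symm_apply_succ]

set_option linter.unusedSectionVars false in
theorem alt_skew {n : ℕ} {K : (Fin (n + 1) → ℂ) → (Fin (n + 1) → R) → M}
    (hK : ∀ (l : ℂ) (b : R) (x : Fin n → ℂ) (a : Fin n → R) (σ : Equiv.Perm (Fin n)),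
      K (Fin.cons l (x ∘ σ)) (Fin.cons b (a ∘ σ)) =
        ((Equiv.Perm.sign σ : ℤ) : ℂ) • K (Fin.cons l x) (Fin.cons b a))
    (x : Fin (n + 1) → ℂ) (a : Fin (n + 1) → R) (σ : Equiv.Perm (Fin (n + 1))) :
    alt K (x ∘ σ) (a ∘ σ) = ((Equiv.Perm.sign σ : ℤ) : ℂ) • alt K x a := by
  have hK' : ∀ (h : Equiv.Perm (Fin (n + 1))), h 0 = 0 → ∀ x a,
      K (x ∘ h) (a ∘ h) = ((Equiv.Perm.sign h : ℤ) : ℂ) • K x a := by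
    intro h h0 x a
    obtain ⟨e, he, hs⟩ := exists_tail_perm h h0
    rw [comp_eq_cons h h0 e he x, comp_eq_cons h h0 e he a, hK, hs, Fin.cons_self_tail, Fin.cons_self_tail]
  simp only [alt, ← comp_cycleRange_symm, Finset.smul_sum]
  refine Fintype.sum_equiv σ _ _ fun i => ?_
  set ρ := (i.cycleRange.symm) with hρ
  set ρ' := ((σ i).cycleRange.symm) with hρ'
  have h0 : (ρ'⁻¹ * σ * ρ) 0 = 0 := by
    simp [ρ, ρ']
  have e1 := hK' (ρ'⁻¹ * σ * ρ) h0 (x ∘ ρ') (a ∘ ρ')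
  rw [show (x ∘ ρ') ∘ (ρ'⁻¹ * σ * ρ) = (x ∘ σ) ∘ ρ by funext k; simp,
    show (a ∘ ρ') ∘ (ρ'⁻¹ * σ * ρ) = (a ∘ σ) ∘ ρ by funext k; simp] at e1
  rw [e1, smul_smul, smul_smul]
  congr 1
  have s1 : Equiv.Perm.sign ρ = (-1) ^ (i : ℕ) := by
    rw [hρ, Equiv.Perm.sign_symm, Fin.sign_cycleRange]
  have s2 : Equiv.Perm.sign ρ' = (-1) ^ (σ i : ℕ) := by
    rw [hρ', Equiv.Perm.sign_symm, Fin.sign_cycleRange]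
  simp only [map_mul, Equiv.Perm.sign_inv, s1, s2]
  push_cast
  have : ((-1 : ℂ) ^ (i : ℕ)) * (-1) ^ (i : ℕ) = 1 := by
    rw [← mul_pow]; simp
  linear_combination ((-1 : ℂ) ^ (σ i : ℕ) * (((Equiv.Perm.sign σ : ℤ)) : ℂ)) * this

theorem tail_update_zero {n : ℕ} {α : Type*} (a : Fin (n + 1) → α) (u : α) :
    Fin.tail (Function.update a 0 u) = Fin.tail a := by
  funext k
  simp [Fin.tail]

theorem update_succ_zero {n : ℕ} {α : Type*} (a : Fin (n + 1) → α) (i : Fin n) (u : α) :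
    Function.update a i.succ u 0 = a 0 :=
  Function.update_of_ne (Fin.succ_ne_zero i).symm _ _

/-- The integrand of `dAct`. -/
def actFun (V : ConformalModule A M) {n : ℕ} (γ : (Fin n → ℂ) → (Fin n → R) → M)
    (x : Fin (n + 1) → ℂ) (a : Fin (n + 1) → R) : M :=
  PolynomialModule.eval (x 0) (V.act (a 0) (γ (Fin.tail x) (Fin.tail a)))

theorem dAct_eq_alt (V : ConformalModule A M) {n : ℕ} (γ : (Fin n → ℂ) → (Fin n → R) → M) :
    dAct V γ = alt (actFun V γ) := by
  funext x a
  simp [dAct, alt, actFun]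

theorem IsPre.actFun (V : ConformalModule A M) {n : ℕ} {γ : (Fin n → ℂ) → (Fin n → R) → M}
    (h : IsPre A γ) : IsPre A (actFun V γ) := by
  refine ⟨fun x => ?_, fun a => ?_, fun x a i => ?_⟩
  · obtain ⟨f, hf⟩ := h.multilinear (Fin.tail x)
    refine ⟨MultilinearMap.mk' (fun a => PolynomialModule.eval (x 0) (V.act (a 0) (f (Fin.tail a))))
      ?_ ?_, fun a => ?_⟩
    · intro a i u v
      refine Fin.cases ?_ (fun i => ?_) i <;> simp [Fin.tail_update_succ, update_succ_zero]
    · intro a i u v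
      refine Fin.cases ?_ (fun i => ?_) i <;> simp [Fin.tail_update_succ, update_succ_zero]
    · simp [LieConf.actFun, hf]
  · have h1 : (fun x => γ (Fin.tail x) (Fin.tail a)) ∈ polyFun (n + 1) M := by
      have := polyFun_comp (fun i => MvPolynomial.X (Fin.succ i)) (h.polynomial (Fin.tail a))
      simp only [MvPolynomial.eval_X] at this
      exact this
    have h2 : ∀ f ∈ polyFun (n + 1) M,
        (fun x => PolynomialModule.eval (x 0) (V.act (a 0) (f x))) ∈ polyFun (n + 1) M := by
      intro f hf
      induction hf using Submodule.span_induction with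
      | mem f hf =>
        obtain ⟨p, v, rfl⟩ := hf
        simp only [map_smul]
        refine polyFun_mul p ?_
        induction V.act (a 0) v using PolynomialModule.induction_linear with
        | zero => simpa using polyFun_zero
        | add p q hp hq => simpa using polyFun_add hp hq
        | single k m =>
          exact Submodule.subset_span ⟨MvPolynomial.X 0 ^ k, m, by simp⟩
      | zero => simpa using polyFun_zero
      | add f g _ _ hf hg => simpa using polyFun_add hf hg
      | smul c f _ hf => simpa using polyFun_smul c hf
    exact h2 _ h1
  · refine Fin.cases ?_ (fun i => ?_) i
    · simp [LieConf.actFun, V.sesq_left]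
    · have := h.antilinear (Fin.tail x) (Fin.tail a) i
      simp only [LieConf.actFun, Fin.tail_update_succ]
      rw [show a i.succ = Fin.tail a i from rfl, this, update_succ_zero]
      simp [Fin.tail]

/-- The integrand of `dBracket`. -/
def brFun (A : LieConformalAlgebra R) {n : ℕ} (γ : (Fin (n + 1) → ℂ) → (Fin (n + 1) → R) → M)
    (x : Fin (n + 2) → ℂ) (a : Fin (n + 2) → R) : M :=
  γ (Fin.cons (x 0 + x 1) (Fin.tail (Fin.tail x)))
    (Fin.cons (PolynomialModule.eval (x 0) (A.bracket (a 0) (a 1))) (Fin.tail (Fin.tail a)))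

theorem tail_update_one {n : ℕ} {α : Type*} (a : Fin (n + 2) → α) (u : α) :
    Fin.tail (Fin.tail (Function.update a 1 u)) = Fin.tail (Fin.tail a) := by
  rw [← Fin.succ_zero_eq_one, Fin.tail_update_succ, tail_update_zero]

theorem IsPre.brFun {n : ℕ} {γ : (Fin (n + 1) → ℂ) → (Fin (n + 1) → R) → M}
    (h : IsPre A γ) : IsPre A (brFun A γ) := by
  refine ⟨fun x => ?_, fun a => ?_, fun x a i => ?_⟩
  · obtain ⟨f, hf⟩ := h.multilinear (Fin.cons (x 0 + x 1) (Fin.tail (Fin.tail x)))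
    refine ⟨MultilinearMap.mk' (fun a => f (Fin.cons
      (PolynomialModule.eval (x 0) (A.bracket (a 0) (a 1))) (Fin.tail (Fin.tail a)))) ?_ ?_,
      fun a => ?_⟩
    · intro a i u v
      refine Fin.cases ?_ (fun i => Fin.cases ?_ (fun i => ?_) i) i
      · simp [MultilinearMap.cons_add]
      · simp [tail_update_one, MultilinearMap.cons_add]
      · have : (1 : Fin (n + 2)) ≠ i.succ.succ := by
          rw [← Fin.succ_zero_eq_one]; simp [Fin.ext_iff]
        simp [Fin.tail_update_succ, Fin.cons_update, this, update_succ_zero]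
    · intro a i u v
      refine Fin.cases ?_ (fun i => Fin.cases ?_ (fun i => ?_) i) i
      · simp [MultilinearMap.cons_smul]
      · simp [tail_update_one, MultilinearMap.cons_smul]
      · have : (1 : Fin (n + 2)) ≠ i.succ.succ := by
          rw [← Fin.succ_zero_eq_one]; simp [Fin.ext_iff]
        simp [Fin.tail_update_succ, Fin.cons_update, this, update_succ_zero]
    · simp [LieConf.brFun, hf]
  · have h1 : ∀ p : PolynomialModule ℂ R, (fun x : Fin (n + 2) → ℂ =>
        γ (Fin.cons (x 0 + x 1) (Fin.tail (Fin.tail x)))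
          (Fin.cons (PolynomialModule.eval (x 0) p) (Fin.tail (Fin.tail a)))) ∈
        polyFun (n + 2) M := by
      intro p
      choose f hf using h.multilinear
      simp only [← hf]
      induction p using PolynomialModule.induction_linear with
      | zero =>
        have : ∀ x : Fin (n + 2) → ℂ, f (Fin.cons (x 0 + x 1) (Fin.tail (Fin.tail x)))
            (Fin.cons (0 : R) (Fin.tail (Fin.tail a))) = 0 :=
          fun x => (f _).map_coord_zero 0 rfl
        simpa [this] using polyFun_zero
      | add p q hp hq => simpa [MultilinearMap.cons_add] using polyFun_add hp hq
      | single k m =>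
        have h2 := h.polynomial (Fin.cons m (Fin.tail (Fin.tail a)))
        have h3 := polyFun_mul (MvPolynomial.X 0 ^ k) (polyFun_comp (m := n + 2)
          (Fin.cons (MvPolynomial.X 0 + MvPolynomial.X 1) fun i => MvPolynomial.X i.succ.succ) h2)
        convert h3 using 2 with x
        have h4 : (fun i => MvPolynomial.eval x ((Fin.cons (MvPolynomial.X 0 + MvPolynomial.X 1)
            fun i => MvPolynomial.X i.succ.succ : Fin (n + 1) → MvPolynomial _ ℂ) i)) =
            (Fin.cons (x 0 + x 1) (Fin.tail (Fin.tail x)) : Fin (n + 1) → ℂ) := by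
          funext k
          refine Fin.cases ?_ (fun k => ?_) k <;> simp [Fin.tail]
        rw [h4, PolynomialModule.eval_single, MultilinearMap.cons_smul, hf]
        simp
    exact h1 _
  · obtain ⟨f, hf⟩ := h.multilinear (Fin.cons (x 0 + x 1) (Fin.tail (Fin.tail x)))
    have h1 : ∀ (r : R), f (Fin.cons (A.der r) (Fin.tail (Fin.tail a))) =
        -((x 0 + x 1) • f (Fin.cons r (Fin.tail (Fin.tail a)))) := by
      intro r
      have := h.antilinear (Fin.cons (x 0 + x 1) (Fin.tail (Fin.tail x)))
        (Fin.cons r (Fin.tail (Fin.tail a))) 0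
      simpa [hf] using this
    simp only [LieConf.brFun, ← hf]
    refine Fin.cases ?_ (fun i => Fin.cases ?_ (fun i => ?_) i) i
    · simp only [Function.update_self, tail_update_zero, ne_eq, one_ne_zero, not_false_eq_true,
        Function.update_of_ne, A.sesq_left]
      rw [← neg_smul, MultilinearMap.cons_smul, neg_smul]
    · simp only [Fin.succ_zero_eq_one, Function.update_self, tail_update_one, ne_eq, zero_ne_one,
        not_false_eq_true, Function.update_of_ne, A.sesq_right]
      rw [MultilinearMap.cons_add, h1, MultilinearMap.cons_smul]
      module
    · have h2 : (1 : Fin (n + 2)) ≠ i.succ.succ := by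
        rw [← Fin.succ_zero_eq_one]; simp [Fin.ext_iff]
      have := h.antilinear (Fin.cons (x 0 + x 1) (Fin.tail (Fin.tail x)))
        (Fin.cons (PolynomialModule.eval (x 0) (A.bracket (a 0) (a 1))) (Fin.tail (Fin.tail a)))
        i.succ
      simpa [Fin.tail_update_succ, Fin.cons_update, h2, hf, Fin.tail, update_succ_zero] using this

/-- Alternation in all but the first argument. -/
def altTail {n : ℕ} (K : (Fin (n + 2) → ℂ) → (Fin (n + 2) → R) → M)
    (x : Fin (n + 2) → ℂ) (a : Fin (n + 2) → R) : M :=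
  alt (fun y c => K (Fin.cons (x 0) y) (Fin.cons (a 0) c)) (Fin.tail x) (Fin.tail a)

theorem IsPre.altTail {n : ℕ} {K : (Fin (n + 2) → ℂ) → (Fin (n + 2) → R) → M} (h : IsPre A K) :
    IsPre A (altTail K) := by
  change IsPre A (fun (x : Fin (n + 2) → ℂ) (a : Fin (n + 2) → R) =>
    ∑ i : Fin (n + 1), (-1 : ℂ) ^ (i : ℕ) •
      K (Fin.cons (x 0) (Fin.cons (Fin.tail x i) (i.removeNth (Fin.tail x))))
        (Fin.cons (a 0) (Fin.cons (Fin.tail a i) (i.removeNth (Fin.tail a)))))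
  refine IsPre.sum _ fun i => IsPre.smul _ ?_
  have := h.perm (Equiv.Perm.decomposeFin.symm (0, i.cycleRange.symm))
  convert this using 3 with x a
  rw [← comp_cycleRange_symm, cons_comp_perm, Fin.cons_self_tail,
    ← comp_cycleRange_symm, cons_comp_perm, Fin.cons_self_tail]

theorem map_subst {N : Type*} [AddCommGroup N] [Module ℂ N] (f : R →ₗ[ℂ] N) (l m : ℂ)
    (hf : ∀ r, f (A.der r) = -((l + m) • f r)) (p : PolynomialModule ℂ R) :
    f (p.coeff.sum fun k c => ((-(l • (1 : Module.End ℂ R)) - A.der) ^ k) c) =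
      f (PolynomialModule.eval m p) := by
  rw [PolynomialModule.eval_apply, map_finsuppSum, map_finsuppSum]
  suffices key : ∀ k c, f (((-(l • (1 : Module.End ℂ R)) - A.der) ^ k) c) = f (m ^ k • c) from
    Finsupp.sum_congr fun k _ => key k _
  intro k c
  induction k generalizing c with
  | zero => simp
  | succ k ih =>
    rw [pow_succ, Module.End.mul_apply, ih, map_smul, map_smul, LinearMap.sub_apply, map_sub, hf]
    simp only [LinearMap.neg_apply, LinearMap.smul_apply, Module.End.one_apply, map_neg, map_smul]
    module

theorem brFun_skew {n : ℕ} {γ : (Fin (n + 1) → ℂ) → (Fin (n + 1) → R) → M}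
    (h : IsPre A γ) (l m : ℂ) (a b : R) (x : Fin n → ℂ) (c : Fin n → R) :
    γ (Fin.cons (l + m) x) (Fin.cons (PolynomialModule.eval l (A.bracket a b)) c) =
      -γ (Fin.cons (m + l) x) (Fin.cons (PolynomialModule.eval m (A.bracket b a)) c) := by
  obtain ⟨f, hf⟩ := h.multilinear (Fin.cons (l + m) x)
  let g : R →ₗ[ℂ] M :=
    { toFun := fun r => f (Fin.cons r c)
      map_add' := fun r s => by simp [MultilinearMap.cons_add]
      map_smul' := fun t r => by simp [MultilinearMap.cons_smul] }
  have hg : ∀ r, g r = γ (Fin.cons (l + m) x) (Fin.cons r c) := fun r => hf _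
  have h1 : ∀ r, g (A.der r) = -((l + m) • g r) := by
    intro r
    have := h.antilinear (Fin.cons (l + m) x) (Fin.cons r c) 0
    simpa [hg] using this
  rw [add_comm m l, ← hg, ← hg, A.skew, map_neg, map_subst g l m h1]

theorem alt_altTail_brFun {n : ℕ} {γ : (Fin (n + 1) → ℂ) → (Fin (n + 1) → R) → M}
    (h : IsPre A γ) (x : Fin (n + 2) → ℂ) (a : Fin (n + 2) → R) :
    alt (altTail (brFun A γ)) x a = (-2 : ℂ) • dBracket A γ x a := by
  simp only [alt, altTail, brFun, Fin.cons_zero, Fin.tail_cons, Fin.cons_one, dBracket,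
    Finset.smul_sum]
  rw [Fin.sum_sum_eq_sum_triangle_add]
  refine Fintype.sum_congr _ _ fun i => Finset.sum_congr rfl fun j hj => ?_
  rw [Finset.mem_Ici] at hj
  have H1 : i.castSucc.succAbove j = j.succ := by simp [Fin.succAbove_of_le_castSucc, hj]
  have H2 : j.succ.succAbove i = i.castSucc := by simp [Fin.succAbove_of_castSucc_lt, hj]
  have H3 : i.predAbove j.succ = j := by simp [Fin.predAbove, hj]
  rw [Fin.removeNth_removeNth_eq_swap x i j.succ, Fin.removeNth_removeNth_eq_swap a i j.succ,
    H2, H3]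
  simp only [Fin.removeNth_apply, H1, H2]
  rw [brFun_skew h (x j.succ) (x i.castSucc) (a j.succ) (a i.castSucc)]
  simp only [Fin.val_castSucc, Fin.val_succ, pow_add, pow_one, pow_two]
  module

theorem dBracket_eq {n : ℕ} {γ : (Fin (n + 1) → ℂ) → (Fin (n + 1) → R) → M}
    (h : IsPre A γ) :
    dBracket A γ = fun x a => (-(1 / 2) : ℂ) • alt (altTail (brFun A γ)) x a := by
  funext x a
  rw [alt_altTail_brFun h, smul_smul]
  norm_num

theorem altTail_brFun_skew (V : ConformalModule A M) {n : ℕ}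
    {γ : (Fin (n + 1) → ℂ) → (Fin (n + 1) → R) → M} (h : IsCochain V γ)
    (l : ℂ) (b : R) (x : Fin (n + 1) → ℂ) (a : Fin (n + 1) → R) (σ : Equiv.Perm (Fin (n + 1))) :
    altTail (brFun A γ) (Fin.cons l (x ∘ σ)) (Fin.cons b (a ∘ σ)) =
      ((Equiv.Perm.sign σ : ℤ) : ℂ) • altTail (brFun A γ) (Fin.cons l x) (Fin.cons b a) := by
  simp only [altTail, Fin.cons_zero, Fin.tail_cons]
  refine alt_skew (fun l' b' y c τ => ?_) x a σ
  simp only [brFun, Fin.cons_zero, Fin.cons_one, Fin.tail_cons]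
  rw [cons_comp_perm, cons_comp_perm, h.skew]
  simp

/-- `d` preserves cochains. -/
theorem IsCochain.dFun {V : ConformalModule A M} {n : ℕ} {γ : (Fin n → ℂ) → (Fin n → R) → M}
    (h : IsCochain V γ) : IsCochain V (dFun V γ) := by
  have h1 : IsPre A (dAct V γ) := dAct_eq_alt V γ ▸ (h.isPre.actFun V).alt
  have s1 : ∀ x a (σ : Equiv.Perm (Fin (n + 1))),
      dAct V γ (x ∘ σ) (a ∘ σ) = ((Equiv.Perm.sign σ : ℤ) : ℂ) • dAct V γ x a := by
    rw [dAct_eq_alt]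
    refine fun x a σ => alt_skew (fun l b x a σ => ?_) x a σ
    simp [actFun, h.skew]
  have h2 : IsPre A (dBracket A γ) ∧ ∀ x a (σ : Equiv.Perm (Fin (n + 1))),
      dBracket A γ (x ∘ σ) (a ∘ σ) = ((Equiv.Perm.sign σ : ℤ) : ℂ) • dBracket A γ x a := by
    cases n with
    | zero => exact ⟨IsPre.zero, fun _ _ _ => (smul_zero _).symm⟩
    | succ n =>
      rw [dBracket_eq h.isPre]
      refine ⟨h.isPre.brFun.altTail.alt.smul _, fun x a σ => ?_⟩
      simp only
      rw [alt_skew (altTail_brFun_skew V h), smul_comm]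
  have h3 := h1.add h2.1
  refine ⟨h3.multilinear, h3.polynomial, h3.antilinear, fun x a σ => ?_⟩
  simp only [LieConf.dFun, s1, h2.2, smul_add]

/-- `∂` preserves cochains. -/
theorem IsCochain.derFun {V : ConformalModule A M} {n : ℕ} {γ : (Fin n → ℂ) → (Fin n → R) → M}
    (h : IsCochain V γ) : IsCochain V (derFun V γ) := by
  refine ⟨fun x => ?_, fun a => ?_, fun x a i => ?_, fun x a σ => ?_⟩
  · obtain ⟨f, hf⟩ := h.multilinear x
    exact ⟨V.der.compMultilinearMap f + (∑ i, x i) • f, fun a => by simp [LieConf.derFun, hf]⟩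
  · have := polyFun_add (polyFun_map V.der (h.polynomial a))
      (polyFun_mul (∑ i, MvPolynomial.X i) (h.polynomial a))
    simpa [LieConf.derFun] using this
  · simp only [LieConf.derFun, h.antilinear, map_neg, map_smul]
    module
  · have : ∑ i, (x ∘ σ) i = ∑ i, x i := Equiv.sum_comp σ x
    simp only [LieConf.derFun, h.skew, this, map_smul]
    module

/-- `d∂ = ∂d`. -/
theorem dFun_derFun (V : ConformalModule A M) {n : ℕ} {γ : (Fin n → ℂ) → (Fin n → R) → M}
    (h : IsCochain V γ) : dFun V (derFun V γ) = derFun V (dFun V γ) := by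
  funext x a
  have h1 : dAct V (derFun V γ) x a = V.der (dAct V γ x a) + (∑ i, x i) • dAct V γ x a := by
    simp only [dAct, map_sum, Finset.smul_sum, ← Finset.sum_add_distrib]
    refine Fintype.sum_congr _ _ fun i => ?_
    rw [Fin.sum_univ_succAbove _ i]
    simp only [derFun, map_add, map_smul, V.sesq_right, Fin.removeNth_apply]
    module
  have h2 : dBracket A (derFun V γ) x a =
      V.der (dBracket A γ x a) + (∑ i, x i) • dBracket A γ x a := by
    cases n with
    | zero => simp [dBracket]
    | succ n =>
      simp only [dBracket, map_sum, Finset.smul_sum, ← Finset.sum_add_distrib]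
      refine Fintype.sum_congr _ _ fun i => Finset.sum_congr rfl fun j hj => ?_
      rw [Finset.mem_Ici] at hj
      have H1 : i.castSucc.succAbove j = j.succ := by simp [Fin.succAbove_of_le_castSucc, hj]
      rw [Fin.sum_univ_succAbove _ i.castSucc, Fin.sum_univ_succAbove _ j, H1]
      simp only [derFun, Fin.sum_univ_succ, Fin.cons_zero, Fin.cons_succ, Fin.removeNth_apply,
        map_smul]
      module
  simp only [dFun, derFun, map_add] at h1 h2 ⊢
  rw [h1, h2]
  module

theorem dFun_add (V : ConformalModule A M) {n : ℕ} (γ δ : (Fin n → ℂ) → (Fin n → R) → M) :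
    dFun V (γ + δ) = dFun V γ + dFun V δ := by
  funext x a
  have h1 : dAct V (γ + δ) x a = dAct V γ x a + dAct V δ x a := by
    simp [dAct, smul_add, Finset.sum_add_distrib]
  have h2 : dBracket A (γ + δ) x a = dBracket A γ x a + dBracket A δ x a := by
    cases n with
    | zero => simp [dBracket]
    | succ n => simp only [dBracket, Pi.add_apply, smul_add, Finset.sum_add_distrib]
  simp only [dFun, Pi.add_apply, h1, h2]
  abel

theorem dFun_smul (V : ConformalModule A M) {n : ℕ} (c : ℂ)
    (γ : (Fin n → ℂ) → (Fin n → R) → M) : dFun V (c • γ) = c • dFun V γ := by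
  funext x a
  have h1 : dAct V (c • γ) x a = c • dAct V γ x a := by
    simp only [dAct, Pi.smul_apply, map_smul, Finset.smul_sum, smul_comm _ c]
  have h2 : dBracket A (c • γ) x a = c • dBracket A γ x a := by
    cases n with
    | zero => simp [dBracket]
    | succ n => simp only [dBracket, Pi.smul_apply, Finset.smul_sum, smul_comm _ c]
  simp only [dFun, Pi.smul_apply, h1, h2, smul_add]

/-! ### The complexes and their cohomology -/

/-- The space `C̃ⁿ(A, V)` of `n`-cochains. -/
def basicCochain (V : ConformalModule A M) (n : ℕ) :
    Submodule ℂ ((Fin n → ℂ) → (Fin n → R) → M) where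
  carrier := {γ | IsCochain V γ}
  zero_mem' := ⟨(IsPre.zero (A := A)).multilinear, (IsPre.zero (A := A)).polynomial,
    (IsPre.zero (A := A)).antilinear, by simp⟩
  add_mem' h k := by
    have hk := h.isPre.add k.isPre
    exact ⟨hk.multilinear, hk.polynomial, hk.antilinear, fun x a σ => by
      simp [h.skew, k.skew]⟩
  smul_mem' c γ h := by
    have hk := h.isPre.smul c
    exact ⟨hk.multilinear, hk.polynomial, hk.antilinear, fun x a σ => by
      simp only [Pi.smul_apply, h.skew]; rw [smul_comm]⟩

/-- The differential `d : C̃ⁿ → C̃ⁿ⁺¹` of the basic complex. -/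
def basicD (V : ConformalModule A M) (n : ℕ) :
    basicCochain V n →ₗ[ℂ] basicCochain V (n + 1) where
  toFun γ := ⟨dFun V γ.1, IsCochain.dFun (V := V) (γ := γ.1) γ.2⟩
  map_add' γ δ := by
    ext x a
    simp only [Submodule.coe_add, Pi.add_apply, dFun_add]
  map_smul' c γ := by
    ext x a
    simp only [Submodule.coe_smul, Pi.smul_apply, dFun_smul, RingHom.id_apply]

/-- The operator `∂ : C̃ⁿ → C̃ⁿ`. -/
def basicDer (V : ConformalModule A M) (n : ℕ) : basicCochain V n →ₗ[ℂ] basicCochain V n where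
  toFun γ := ⟨derFun V γ.1, IsCochain.derFun (V := V) (γ := γ.1) γ.2⟩
  map_add' γ δ := by
    ext x a
    simp only [derFun, Submodule.coe_add, Pi.add_apply, map_add]
    module
  map_smul' c γ := by
    ext x a
    simp only [derFun, Submodule.coe_smul, Pi.smul_apply, map_smul, RingHom.id_apply]
    module

theorem basicD_basicDer (V : ConformalModule A M) (n : ℕ) (γ : basicCochain V n) :
    basicD V n (basicDer V n γ) = basicDer V (n + 1) (basicD V n γ) :=
  Subtype.ext (dFun_derFun V (γ := γ.1) γ.2)

/-- The space `Cⁿ(A, V) = C̃ⁿ / ∂C̃ⁿ` of reduced `n`-cochains. -/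
abbrev ReducedCochain (V : ConformalModule A M) (n : ℕ) : Type _ :=
  basicCochain V n ⧸ LinearMap.range (basicDer V n)

/-- The differential `Cⁿ → Cⁿ⁺¹` of the reduced complex, induced by `d`. -/
def reducedD (V : ConformalModule A M) (n : ℕ) :
    ReducedCochain V n →ₗ[ℂ] ReducedCochain V (n + 1) :=
  Submodule.mapQ _ _ (basicD V n) (by
    rintro _ ⟨γ, rfl⟩
    exact ⟨basicD V n γ, (basicD_basicDer V n γ).symm⟩)

end Cochains

section Cohomology

variable {C : ℕ → Type*} [∀ n, AddCommGroup (C n)] [∀ n, Module ℂ (C n)]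

/-- The coboundaries in degree `n` of a cochain complex `C 0 → C 1 → C 2 → ⋯`. -/
def coboundaries (d : ∀ n, C n →ₗ[ℂ] C (n + 1)) : (n : ℕ) → Submodule ℂ (C n)
  | 0 => ⊥
  | n + 1 => LinearMap.range (d n)

/-- The `n`-th cohomology `ker d / im d` of a cochain complex `C 0 → C 1 → C 2 → ⋯`. -/
abbrev Cohomology (d : ∀ n, C n →ₗ[ℂ] C (n + 1)) (n : ℕ) : Type _ :=
  LinearMap.ker (d n) ⧸ (coboundaries d n).submoduleOf (LinearMap.ker (d n))

end Cohomology

section Cohomology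

variable {R : Type*} [AddCommGroup R] [Module ℂ R] {A : LieConformalAlgebra R}
variable {M : Type*} [AddCommGroup M] [Module ℂ M]

/-- The basic cohomology `H̃ⁿ(A, V)`. -/
abbrev BasicCohomology (V : ConformalModule A M) (n : ℕ) : Type _ :=
  Cohomology (C := fun k => basicCochain V k) (basicD V) n

/-- The reduced cohomology `Hⁿ(A, V)`. -/
abbrev ReducedCohomology (V : ConformalModule A M) (n : ℕ) : Type _ :=
  Cohomology (C := fun k => ReducedCochain V k) (reducedD V) n

end Cohomology

end LieConf

end

/-! Everything rests on one homotopy. Let `ι` be contraction with `J 0` at `λ = 0`. Since `[J_0 _0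
r] = ∂r` for all `r`, the Cartan formula reads `ιd + dι = ∂ + α` whenever `J_0` acts on the module
at `λ = 0` as `∂ + α` (`dFun_cons`; in degree `0` there is no `dι` term). On the reduced complex `∂`
is zero, so multiplication by `α` is null-homotopic, and the cohomology vanishes in all degrees if
`α ≠ 0` (`rank_reducedCohomology_eq_zero`). For `ℂ_a` the constant is `-a`; for `M_{Δ,α}` it is `α`.

For trivial coefficients the constant is `0`, and a basic cocycle of positive degree satisfies only
`∂γ = dιγ`. There `∂` is multiplication by `∑ λ_i`: it is injective in positive degrees, and its
image is exactly the cochains vanishing on `∑ λ_i = 0` (`exists_basicDer_eq`). A `1`-cochain `β`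
whose differential vanishes on `λ_1 + λ_2 = 0` lies in the image of `∂`, because `(dβ)_{x,-x}(J_k,
J_0)` is `-(k + 2) x β_0(J_k)`. This gives the reduced `H^1`. It also gives the basic `H^2`: for a
`2`-cocycle `γ`, `dιγ = ∂γ` vanishes there, so `ιγ = ∂ω`, hence `∂γ = ∂dω` and `γ = dω`.

For the reduced `H^2`, put `F_ij(λ) = γ_{λ,-λ}(J_i, J_j)`. The cocycle condition on `(J_i, J_j,
J_0)` is a functional equation. It forces `F_ij` to be an odd polynomial depending only on `i + j`,
linear when `i + j > 0` and a combination of `λ` and `λ³` when `i = j = 0` (`reduced_two_cocycle`).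
The linear terms are the coboundaries of `1`-cochains. The cubic term is the Virasoro cocycle, and
it survives because coboundaries of `1`-cochains are linear in `λ` on the antidiagonal. -/

noncomputable section

namespace LieConf


/-! ### The contraction with an element and the Cartan formula -/

section Contraction

variable {R : Type*} [AddCommGroup R] [Module ℂ R] {A : LieConformalAlgebra R}
variable {M : Type*} [AddCommGroup M] [Module ℂ M]

/-- The contraction `γ ↦ γ_{0, λ_1, …, λ_n}(b, …)` with an element `b`. -/
def contractFun (b : R) {n : ℕ} (γ : (Fin (n + 1) → ℂ) → (Fin (n + 1) → R) → M)
    (x : Fin n → ℂ) (a : Fin n → R) : M :=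
  γ (Fin.cons 0 x) (Fin.cons b a)

theorem IsCochain.contractFun {V : ConformalModule A M} (b : R) {n : ℕ}
    {γ : (Fin (n + 1) → ℂ) → (Fin (n + 1) → R) → M} (h : IsCochain V γ) :
    IsCochain V (contractFun b γ) := by
  refine ⟨fun x => ?_, fun a => ?_, fun x a i => ?_, fun x a σ => ?_⟩
  · obtain ⟨f, hf⟩ := h.multilinear (Fin.cons 0 x)
    exact ⟨f.curryLeft b, fun a => hf _⟩
  · have := polyFun_comp (m := n) (Fin.cons 0 MvPolynomial.X)
      (h.polynomial (Fin.cons b a))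
    convert this using 2 with x
    simp only [LieConf.contractFun]
    congr 1
    funext k
    refine Fin.cases ?_ (fun k => ?_) k <;> simp
  · have := h.antilinear (Fin.cons 0 x) (Fin.cons b a) i.succ
    simpa [LieConf.contractFun, Fin.cons_update] using this
  · simp only [LieConf.contractFun]
    rw [cons_comp_perm, cons_comp_perm, h.skew]
    simp

theorem cons_cons_eq_comp_swap {n : ℕ} {α : Type*} (s t : α) (x : Fin n → α) :
    (Fin.cons s (Fin.cons t x) : Fin (n + 2) → α) =
      (Fin.cons t (Fin.cons s x) : Fin (n + 2) → α) ∘ Equiv.swap 0 1 := by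
  funext k
  refine Fin.cases ?_ (fun k => Fin.cases ?_ (fun k => ?_) k) k
  · simp
  · simp
  · rw [Function.comp_apply, Equiv.swap_apply_of_ne_of_ne] <;> simp [Fin.ext_iff]

/-- Exchanging the first two arguments of a cochain changes its sign. -/
theorem IsCochain.swap {V : ConformalModule A M} {n : ℕ}
    {γ : (Fin (n + 2) → ℂ) → (Fin (n + 2) → R) → M} (h : IsCochain V γ) (s t : ℂ) (u v : R)
    (x : Fin n → ℂ) (a : Fin n → R) :
    γ (Fin.cons s (Fin.cons t x)) (Fin.cons u (Fin.cons v a)) =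
      -γ (Fin.cons t (Fin.cons s x)) (Fin.cons v (Fin.cons u a)) := by
  rw [cons_cons_eq_comp_swap s t x, cons_cons_eq_comp_swap u v a, h.skew,
    Equiv.Perm.sign_swap (by simp)]
  simp

/-- A cochain is unchanged, up to sign, when an argument is moved to the front. -/
theorem IsCochain.cons_removeNth {V : ConformalModule A M} {n : ℕ}
    {γ : (Fin (n + 1) → ℂ) → (Fin (n + 1) → R) → M} (h : IsCochain V γ)
    (x : Fin (n + 1) → ℂ) (a : Fin (n + 1) → R) (i : Fin (n + 1)) :
    γ (Fin.cons (x i) (i.removeNth x)) (Fin.cons (a i) (i.removeNth a)) =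
      (-1 : ℂ) ^ (i : ℕ) • γ x a := by
  rw [← comp_cycleRange_symm, ← comp_cycleRange_symm, h.skew, Equiv.Perm.sign_symm,
    Fin.sign_cycleRange]
  simp

theorem removeNth_succ_cons {n : ℕ} {α : Type*} (u : α) (x : Fin (n + 1) → α)
    (i : Fin (n + 1)) :
    i.succ.removeNth (Fin.cons u x : Fin (n + 2) → α) = Fin.cons u (i.removeNth x) := by
  funext k
  refine Fin.cases ?_ (fun k => ?_) k <;> simp [Fin.removeNth]

/-- The index `0` contributes the action of `b`. Every other index is shifted by one, which flips
its sign and leaves `b` in front. -/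
theorem dAct_cons (V : ConformalModule A M) (b : R) {n : ℕ}
    (γ : (Fin (n + 1) → ℂ) → (Fin (n + 1) → R) → M)
    (x : Fin (n + 1) → ℂ) (a : Fin (n + 1) → R) :
    dAct V γ (Fin.cons 0 x) (Fin.cons b a) =
      PolynomialModule.eval 0 (V.act b (γ x a)) - dAct V (contractFun b γ) x a := by
  simp only [dAct]
  rw [Fin.sum_univ_succ, sub_eq_add_neg, ← Finset.sum_neg_distrib]
  congr 1
  · simp
  · refine Fintype.sum_congr _ _ fun i => ?_
    simp only [removeNth_succ_cons, Fin.cons_succ, contractFun, Fin.val_succ, pow_succ]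
    module

theorem antilinear_cons {n : ℕ} {γ : (Fin (n + 1) → ℂ) → (Fin (n + 1) → R) → M}
    (h : IsPre A γ) (l : ℂ) (b : R) (x : Fin n → ℂ) (a : Fin n → R) :
    γ (Fin.cons l x) (Fin.cons (A.der b) a) = -(l • γ (Fin.cons l x) (Fin.cons b a)) := by
  simpa using h.antilinear (Fin.cons l x) (Fin.cons b a) 0

/-- A pair `(0, j)` produces `[b_0 a_j] = ∂a_j`, which antilinearity turns into the factor `-λ_j`;
moving `a_j` back to its place cancels the sign, and the sum over `j` is the `∑ λ_i` part of `∂γ`.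
The pairs avoiding `0` assemble into the bracket part of the differential of the contraction. -/
theorem dBracket_cons {V : ConformalModule A M} {b : R}
    (hb : ∀ r, PolynomialModule.eval 0 (A.bracket b r) = A.der r) {n : ℕ}
    {γ : (Fin (n + 1) → ℂ) → (Fin (n + 1) → R) → M} (h : IsCochain V γ)
    (x : Fin (n + 1) → ℂ) (a : Fin (n + 1) → R) :
    dBracket A γ (Fin.cons 0 x) (Fin.cons b a) =
      (∑ i, x i) • γ x a - dBracket A (contractFun b γ) x a := by
  have h0 : ∑ j ≥ (0 : Fin (n + 1)), (-1 : ℂ) ^ (0 + 1 + ((j : ℕ) + 2)) •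
      γ (Fin.cons (0 + x j) (j.removeNth x))
        (Fin.cons (PolynomialModule.eval 0 (A.bracket b (a j))) (j.removeNth a)) =
      (∑ i, x i) • γ x a := by
    have hI : Finset.Ici (0 : Fin (n + 1)) = Finset.univ := by ext; simp
    rw [Finset.sum_smul, hI]
    refine Fintype.sum_congr _ _ fun j => ?_
    have h1 : (-1 : ℂ) ^ (0 + 1 + ((j : ℕ) + 2)) = -(-1) ^ (j : ℕ) := by ring
    have h2 : (-1 : ℂ) ^ (j : ℕ) * (-1) ^ (j : ℕ) = 1 := by rw [← mul_pow]; simp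
    rw [hb, antilinear_cons h.isPre, zero_add (x j), h.cons_removeNth, h1, neg_smul, smul_neg,
      neg_neg, smul_smul, smul_smul]
    congr 1
    linear_combination x j * h2
  cases n with
  -- The contraction is now a `0`-cochain, whose bracket part is zero by definition, so only the
  -- pair `(0, 1)` remains.
  | zero =>
    simp only [dBracket, sub_zero]
    rw [Fin.sum_univ_one, ← h0]
    refine Finset.sum_congr rfl fun j _ => ?_
    obtain rfl : j = 0 := Fin.fin_one_eq_zero j
    simp
  | succ n =>
    simp only [dBracket]
    rw [Fin.sum_univ_succ, sub_eq_add_neg, ← Finset.sum_neg_distrib]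
    refine congrArg₂ (· + ·) h0 (Fintype.sum_congr _ _ fun i => ?_)
    rw [← Fin.map_succEmb_Ici, Finset.sum_map, ← Finset.sum_neg_distrib]
    refine Finset.sum_congr rfl fun j _ => ?_
    simp only [Fin.coe_succEmb, ← Fin.succ_castSucc, removeNth_succ_cons, Fin.cons_succ,
      contractFun, Fin.val_succ]
    -- Here the bracket stands first and `b` second. Exchanging them gives the minus sign; the shift
    -- of both indices raises the exponent by two and changes nothing.
    rw [h.swap, smul_neg]
    congr 2
    ring

/-- The Cartan formula for an element `b` with `[b_0 r] = ∂r`. -/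
theorem dFun_cons {V : ConformalModule A M} {b : R}
    (hb : ∀ r, PolynomialModule.eval 0 (A.bracket b r) = A.der r) {α : ℂ}
    (hα : ∀ v, PolynomialModule.eval 0 (V.act b v) = V.der v + α • v) {n : ℕ}
    {γ : (Fin (n + 1) → ℂ) → (Fin (n + 1) → R) → M} (h : IsCochain V γ) :
    contractFun b (dFun V γ) = derFun V γ + α • γ - dFun V (contractFun b γ) := by
  funext x a
  simp only [contractFun, dFun, dAct_cons, dBracket_cons hb h, hα, derFun, Pi.sub_apply,
    Pi.add_apply, Pi.smul_apply]
  module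

/-- The Cartan formula in degree `0`, where no contraction of `γ` exists. No condition on `[b_0 r]`
is needed, as no brackets occur. -/
theorem dFun_cons_zero {V : ConformalModule A M} {b : R} {α : ℂ}
    (hα : ∀ v, PolynomialModule.eval 0 (V.act b v) = V.der v + α • v)
    {γ : (Fin 0 → ℂ) → (Fin 0 → R) → M} :
    contractFun b (dFun V γ) = derFun V γ + α • γ := by
  funext x a
  simp [contractFun, dFun, dAct, dBracket, hα, derFun, Subsingleton.elim _ x,
    Subsingleton.elim _ a]

/-- The variable attached to `b` is `0`, so it adds nothing to `∑ λ_i`. This is what makes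
contraction descend to the reduced complex. -/
theorem contractFun_derFun (V : ConformalModule A M) (b : R) {n : ℕ}
    (γ : (Fin (n + 1) → ℂ) → (Fin (n + 1) → R) → M) :
    contractFun b (derFun V γ) = derFun V (contractFun b γ) := by
  funext x a
  simp [contractFun, derFun, Fin.sum_univ_succ]

/-- The contraction with `b` as a map of cochains. -/
def contract (V : ConformalModule A M) (b : R) (n : ℕ) (γ : basicCochain V (n + 1)) :
    basicCochain V n :=
  ⟨contractFun b γ.1, IsCochain.contractFun (V := V) b (γ := γ.1) γ.2⟩

theorem contract_basicDer (V : ConformalModule A M) (b : R) (n : ℕ)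
    (γ : basicCochain V (n + 1)) :
    contract V b n (basicDer V (n + 1) γ) = basicDer V n (contract V b n γ) :=
  Subtype.ext (contractFun_derFun V b γ.1)

theorem contract_basicD {V : ConformalModule A M} {b : R}
    (hb : ∀ r, PolynomialModule.eval 0 (A.bracket b r) = A.der r) {α : ℂ}
    (hα : ∀ v, PolynomialModule.eval 0 (V.act b v) = V.der v + α • v) (n : ℕ)
    (γ : basicCochain V (n + 1)) :
    contract V b (n + 1) (basicD V (n + 1) γ) =
      basicDer V (n + 1) γ + α • γ - basicD V n (contract V b n γ) :=
  Subtype.ext (dFun_cons hb hα γ.2)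

theorem contract_basicD_zero {V : ConformalModule A M} {b : R} {α : ℂ}
    (hα : ∀ v, PolynomialModule.eval 0 (V.act b v) = V.der v + α • v) (γ : basicCochain V 0) :
    contract V b 0 (basicD V 0 γ) = basicDer V 0 γ + α • γ :=
  Subtype.ext (dFun_cons_zero hα)

/-! ### Representatives in the reduced complex and criteria for cohomology of dimension `0` or `1`
-/

theorem reducedD_mk (V : ConformalModule A M) (n : ℕ) (γ : basicCochain V n) :
    reducedD V n (Submodule.Quotient.mk γ) = Submodule.Quotient.mk (basicD V n γ) := rfl

theorem reducedD_mk_eq_zero (V : ConformalModule A M) (n : ℕ) (γ : basicCochain V n) :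
    reducedD V n (Submodule.Quotient.mk γ) = 0 ↔
      ∃ ω, basicDer V (n + 1) ω = basicD V n γ := by
  rw [reducedD_mk, Submodule.Quotient.mk_eq_zero, LinearMap.mem_range]

theorem rank_cohomology_eq_zero {C : ℕ → Type*} [∀ n, AddCommGroup (C n)]
    [∀ n, Module ℂ (C n)] (d : ∀ n, C n →ₗ[ℂ] C (n + 1)) (n : ℕ)
    (h : ∀ z, d n z = 0 → z ∈ coboundaries d n) : Module.rank ℂ (Cohomology d n) = 0 := by
  have : Subsingleton (Cohomology d n) := by
    rw [Submodule.Quotient.subsingleton_iff, eq_top_iff]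
    exact fun z _ => h z.1 z.2
  exact rank_subsingleton' _ _

theorem rank_cohomology_eq_one {C : ℕ → Type*} [∀ n, AddCommGroup (C n)]
    [∀ n, Module ℂ (C n)] (d : ∀ n, C n →ₗ[ℂ] C (n + 1)) (n : ℕ) (z : C n) (hz : d n z = 0)
    (hz' : z ∉ coboundaries d n)
    (h : ∀ w, d n w = 0 → ∃ c : ℂ, w - c • z ∈ coboundaries d n) :
    Module.rank ℂ (Cohomology d n) = 1 ∧
      Submodule.span ℂ {(Submodule.Quotient.mk ⟨z, hz⟩ : Cohomology d n)} = ⊤ := by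
  have key : ∀ w : Cohomology d n, ∃ c : ℂ,
      c • (Submodule.Quotient.mk ⟨z, hz⟩ : Cohomology d n) = w := by
    intro w
    obtain ⟨⟨w, hw⟩, rfl⟩ := Submodule.Quotient.mk_surjective _ w
    obtain ⟨c, hc⟩ := h w hw
    refine ⟨c, ?_⟩
    rw [← Submodule.Quotient.mk_smul, eq_comm, Submodule.Quotient.eq]
    exact hc
  refine ⟨rank_eq_one _ (fun h0 => hz' ?_) key, ?_⟩
  · rw [Submodule.Quotient.mk_eq_zero] at h0
    exact h0
  · rw [eq_top_iff]
    exact fun w _ => Submodule.mem_span_singleton.2 (key w)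

/-- The reduced cohomology vanishes if an element `b` with `[b_0 r] = ∂r` acts at `λ = 0` as
`∂ + α` with `α ≠ 0`. -/
theorem rank_reducedCohomology_eq_zero {V : ConformalModule A M} {b : R}
    (hb : ∀ r, PolynomialModule.eval 0 (A.bracket b r) = A.der r) {α : ℂ} (h0 : α ≠ 0)
    (hα : ∀ v, PolynomialModule.eval 0 (V.act b v) = V.der v + α • v) (n : ℕ) :
    Module.rank ℂ (ReducedCohomology V n) = 0 := by
  refine rank_cohomology_eq_zero _ n fun z hz => ?_
  obtain ⟨γ, rfl⟩ := Submodule.Quotient.mk_surjective _ z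
  obtain ⟨ω, hω⟩ := (reducedD_mk_eq_zero V n γ).1 hz
  have h1 := congrArg (contract V b n) hω
  rw [contract_basicDer] at h1
  cases n with
  | zero =>
    rw [contract_basicD_zero hα] at h1
    change _ = (0 : ReducedCochain V 0)
    rw [Submodule.Quotient.mk_eq_zero]
    -- With `dγ = ∂ω`, contraction gives `∂ιω = ∂γ + αγ`, so `αγ = ∂(ιω - γ)`.
    refine ⟨α⁻¹ • (contract V b 0 ω - γ), ?_⟩
    rw [map_smul, map_sub, h1, add_sub_cancel_left, inv_smul_smul₀ h0]
  | succ n =>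
    rw [contract_basicD hb hα] at h1
    -- Now `∂ιω = ∂γ + αγ - dιγ`. Modulo `∂` this says that `γ` is `d` of `α⁻¹ιγ`; the error term is
    -- `∂` of `α⁻¹(ιω - γ)`.
    refine ⟨Submodule.Quotient.mk (α⁻¹ • contract V b n γ), ?_⟩
    rw [reducedD_mk, eq_comm, Submodule.Quotient.eq]
    refine ⟨α⁻¹ • (contract V b (n + 1) ω - γ), ?_⟩
    rw [map_smul, map_sub, h1, map_smul]
    have h2 : α⁻¹ • α • γ = γ := inv_smul_smul₀ h0 γ
    linear_combination (norm := module) h2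

end Contraction

/-! ### Vanishing for `ℂ_a` and `M_{Δ,α}` -/

/-- At `λ = 0` and `i = 0` the factor `(i+1)∂ + (i+j+2)λ` is just `∂`, for every `j`. So `J 0` is an
element to which the Cartan formula applies. -/
theorem blockB_bracket_J_zero (r : Block) :
    PolynomialModule.eval 0 (blockB.bracket (J 0) r) = blockB.der r := by
  induction r using Finsupp.induction_linear with
  | zero => simp
  | add r s hr hs => simp only [map_add, hr, hs]
  | single j g =>
    simp only [blockB, J, eval_blockBracket_single, blockDer_single]
    simp [mul_comm]

/-- `J 0` acts by zero while `∂` acts by `a`, so the constant with `0 = ∂ + α` is `α = -a`. -/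
theorem rank_reducedCohomology_scalarModule {a : ℂ} (ha : a ≠ 0) (q : ℕ) :
    Module.rank ℂ (ReducedCohomology (scalarModule blockB a) q) = 0 :=
  rank_reducedCohomology_eq_zero (b := J 0) (α := -a) blockB_bracket_J_zero (neg_ne_zero.2 ha)
    (fun v => by simp [scalarModule]) q

theorem rank_reducedCohomology_rankOneModule (Δ : ℂ) {α : ℂ} (hα : α ≠ 0) (q : ℕ) :
    Module.rank ℂ (ReducedCohomology (rankOneModule Δ α) q) = 0 :=
  rank_reducedCohomology_eq_zero (b := J 0) (α := α) blockB_bracket_J_zero hα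
    (fun v => by
      simp [rankOneModule, eval_rankOneAct, J, smul_eq_C_mul]
      ring) q


/-! ### Division of scalar-valued cochains by `∑ λ_i` -/

theorem mem_polyFun_complex {n : ℕ} {f : (Fin n → ℂ) → ℂ} (hf : f ∈ polyFun n ℂ) :
    ∃ p : MvPolynomial (Fin n) ℂ, ∀ x, f x = MvPolynomial.eval x p := by
  induction hf using Submodule.span_induction with
  | mem f hf =>
    obtain ⟨p, v, rfl⟩ := hf
    exact ⟨p * MvPolynomial.C v, fun x => by simp⟩
  | zero => exact ⟨0, fun x => by simp⟩
  | add f g _ _ hf hg =>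
    obtain ⟨p, hp⟩ := hf
    obtain ⟨q, hq⟩ := hg
    exact ⟨p + q, fun x => by simp [hp, hq]⟩
  | smul c f _ hf =>
    obtain ⟨p, hp⟩ := hf
    exact ⟨c • p, fun x => by simp [hp]⟩

theorem eval_mem_polyFun {n : ℕ} (p : MvPolynomial (Fin n) ℂ) :
    (fun x => MvPolynomial.eval x p) ∈ polyFun n ℂ :=
  Submodule.subset_span ⟨p, 1, by simp⟩

theorem sum_X_ne_zero (n : ℕ) :
    (∑ i, MvPolynomial.X i : MvPolynomial (Fin (n + 1)) ℂ) ≠ 0 := by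
  intro h
  have := congrArg (MvPolynomial.eval (Pi.single 0 1 : Fin (n + 1) → ℂ)) h
  simp at this

/-- A polynomial function is determined by its product with `∑ λ_i`. -/
theorem polyFun_eq_zero_of_sum_mul {n : ℕ} {f : (Fin (n + 1) → ℂ) → ℂ}
    (hf : f ∈ polyFun (n + 1) ℂ) (h : ∀ x, (∑ i, x i) * f x = 0) (x : Fin (n + 1) → ℂ) :
    f x = 0 := by
  obtain ⟨p, hp⟩ := mem_polyFun_complex hf
  have h0 : (∑ i, MvPolynomial.X i) * p = 0 :=
    MvPolynomial.funext fun x => by simpa [hp] using h x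
  rw [hp, (mul_eq_zero.1 h0).resolve_left (sum_X_ne_zero n), map_zero]

theorem polyFun_eq_of_sum_mul {n : ℕ} {f g : (Fin (n + 1) → ℂ) → ℂ}
    (hf : f ∈ polyFun (n + 1) ℂ) (hg : g ∈ polyFun (n + 1) ℂ)
    (h : ∀ x, (∑ i, x i) * f x = (∑ i, x i) * g x) (x : Fin (n + 1) → ℂ) : f x = g x :=
  sub_eq_zero.1 (polyFun_eq_zero_of_sum_mul (Submodule.sub_mem _ hf hg)
    (fun x => by simp [mul_sub, h]) x)

/-- A polynomial that vanishes on the hyperplane `∑ x_i = 0` is divisible by `∑ X_i`. -/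
theorem sum_X_dvd {n : ℕ} (p : MvPolynomial (Fin (n + 1)) ℂ)
    (hp : ∀ x : Fin (n + 1) → ℂ, ∑ i, x i = 0 → MvPolynomial.eval x p = 0) :
    (∑ i, MvPolynomial.X i) ∣ p := by
  -- The substitution `X_0 ↦ -∑_{i>0} X_i` parametrises the hyperplane, so it sends `p` to zero.
  let q : Fin (n + 1) → MvPolynomial (Fin (n + 1)) ℂ :=
    Fin.cons (-∑ i : Fin n, MvPolynomial.X i.succ) fun i => MvPolynomial.X i.succ
  have h1 : MvPolynomial.bind₁ q p = 0 := by
    refine MvPolynomial.funext fun x => ?_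
    rw [map_zero, ← hp (fun i => MvPolynomial.eval x (q i))]
    · exact MvPolynomial.eval₂Hom_bind₁ (RingHom.id ℂ) x q p
    · simp [q, Fin.sum_univ_succ]
  let I : Ideal (MvPolynomial (Fin (n + 1)) ℂ) := Ideal.span {∑ i, MvPolynomial.X i}
  -- The same substitution is the identity modulo `∑ X_i`, hence `p` is congruent to `0`.
  have h2 : (Ideal.Quotient.mkₐ ℂ I).comp (MvPolynomial.bind₁ q) = Ideal.Quotient.mkₐ ℂ I := by
    refine MvPolynomial.algHom_ext fun i => ?_
    simp only [AlgHom.comp_apply, MvPolynomial.bind₁_X_right, Ideal.Quotient.mkₐ_eq_mk]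
    refine Fin.cases ?_ (fun i => ?_) i
    · rw [eq_comm, Ideal.Quotient.mk_eq_mk_iff_sub_mem, Ideal.mem_span_singleton]
      simp [q, Fin.sum_univ_succ]
    · simp [q]
  rw [← Ideal.mem_span_singleton, ← Ideal.Quotient.eq_zero_iff_mem]
  have h3 := DFunLike.congr_fun h2 p
  rw [AlgHom.comp_apply, h1, map_zero] at h3
  exact h3.symm

/-! ### Trivial coefficients over an arbitrary Lie conformal algebra -/

section Trivial

variable {R : Type*} [AddCommGroup R] [Module ℂ R] {A : LieConformalAlgebra R}

theorem derFun_trivialModule {n : ℕ} (γ : (Fin n → ℂ) → (Fin n → R) → ℂ) (x : Fin n → ℂ)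
    (a : Fin n → R) : derFun (trivialModule A) γ x a = (∑ i, x i) * γ x a := by
  simp [derFun, scalarModule]

theorem dAct_trivialModule {n : ℕ} (γ : (Fin n → ℂ) → (Fin n → R) → ℂ)
    (x : Fin (n + 1) → ℂ) (a : Fin (n + 1) → R) : dAct (trivialModule A) γ x a = 0 := by
  simp [dAct, scalarModule]

theorem IsCochain.update_add {M : Type*} [AddCommGroup M] [Module ℂ M]
    {V : ConformalModule A M} {n : ℕ} {γ : (Fin n → ℂ) → (Fin n → R) → M}
    (h : IsCochain V γ) (x : Fin n → ℂ) (a : Fin n → R) (i : Fin n) (u v : R) :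
    γ x (Function.update a i (u + v)) =
      γ x (Function.update a i u) + γ x (Function.update a i v) := by
  obtain ⟨f, hf⟩ := h.multilinear x
  simp [← hf]

theorem IsCochain.update_smul {M : Type*} [AddCommGroup M] [Module ℂ M]
    {V : ConformalModule A M} {n : ℕ} {γ : (Fin n → ℂ) → (Fin n → R) → M}
    (h : IsCochain V γ) (x : Fin n → ℂ) (a : Fin n → R) (i : Fin n) (c : ℂ) (u : R) :
    γ x (Function.update a i (c • u)) = c • γ x (Function.update a i u) := by
  obtain ⟨f, hf⟩ := h.multilinear x
  simp [← hf]

/-- A scalar-valued function that is polynomial in the `λ_i` is a cochain if its product with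
`∑ λ_i` is. -/
theorem IsCochain.of_derFun {n : ℕ} {ω : (Fin (n + 1) → ℂ) → (Fin (n + 1) → R) → ℂ}
    (hω : ∀ a, (fun x => ω x a) ∈ polyFun (n + 1) ℂ)
    (h : IsCochain (trivialModule A) (LieConf.derFun (trivialModule A) ω)) :
    IsCochain (trivialModule A) ω := by
  have hd := derFun_trivialModule (A := A) ω
  -- Each remaining axiom is an equality of polynomial functions of `x`, so it may be checked after
  -- multiplication by `∑ λ_i`, where it is the axiom for `∂ω`. Pointwise division would fail on the
  -- hyperplane.
  refine ⟨fun x => ⟨MultilinearMap.mk' (ω x) (fun a i u v => ?_) (fun a i c u => ?_),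
    fun a => rfl⟩, hω, fun x a i => ?_, fun x a σ => ?_⟩
  · refine polyFun_eq_of_sum_mul (hω _) (polyFun_add (hω _) (hω _)) (fun x => ?_) x
    rw [mul_add, ← hd, ← hd, ← hd, h.update_add]
  · refine polyFun_eq_of_sum_mul (hω _) (polyFun_smul c (hω _)) (fun x => ?_) x
    rw [mul_smul_comm, ← hd, ← hd, h.update_smul]
  · have h1 := polyFun_smul (-1) (polyFun_mul (MvPolynomial.X i) (hω a))
    simp only [MvPolynomial.eval_X, neg_smul, one_smul] at h1
    refine polyFun_eq_of_sum_mul (hω _) h1 (fun x => ?_) x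
    have := h.antilinear x a i
    rw [hd, hd] at this
    rw [this, smul_eq_mul, smul_eq_mul]
    ring
  · have h1 := polyFun_comp (fun i => MvPolynomial.X (σ i)) (hω (a ∘ σ))
    simp only [MvPolynomial.eval_X] at h1
    refine polyFun_eq_of_sum_mul (f := fun x => ω (x ∘ σ) (a ∘ σ)) h1
      (polyFun_smul _ (hω a)) (fun x => ?_) x
    have := h.skew x a σ
    rw [hd, hd, show ∑ i, (x ∘ σ) i = ∑ i, x i from Equiv.sum_comp σ x] at this
    rw [this, mul_smul_comm]

/-- A scalar-valued cochain that vanishes on `∑ λ_i = 0` is in the image of `∂`. -/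
theorem exists_basicDer_eq {n : ℕ} (γ : basicCochain (trivialModule A) (n + 1))
    (h : ∀ x a, ∑ i, x i = 0 → γ.1 x a = 0) :
    ∃ ω, basicDer (trivialModule A) (n + 1) ω = γ := by
  have hγ : IsCochain (trivialModule A) γ.1 := γ.2
  have key : ∀ a, ∃ q : MvPolynomial (Fin (n + 1)) ℂ,
      ∀ x, γ.1 x a = (∑ i, x i) * MvPolynomial.eval x q := by
    intro a
    obtain ⟨p, hp⟩ := mem_polyFun_complex (hγ.polynomial a)
    obtain ⟨q, rfl⟩ := sum_X_dvd p fun x hx => by rw [← hp, h x a hx]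
    exact ⟨q, fun x => by simp [hp]⟩
  choose q hq using key
  have hω : derFun (trivialModule A) (fun x a => MvPolynomial.eval x (q a)) = γ.1 := by
    funext x a
    rw [derFun_trivialModule, hq]
  exact ⟨⟨fun x a => MvPolynomial.eval x (q a),
    IsCochain.of_derFun (fun a => eval_mem_polyFun (q a)) (hω ▸ hγ)⟩, Subtype.ext hω⟩

/-- There is at least one variable, so `∑ λ_i` is a nonzero element of a domain. In degree `0` the
sum is empty and `∂` is zero. -/
theorem basicDer_injective (n : ℕ) :
    Function.Injective (basicDer (trivialModule A) (n + 1)) := by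
  rw [injective_iff_map_eq_zero]
  intro γ h
  refine Subtype.ext (funext fun x => funext fun a => ?_)
  refine polyFun_eq_zero_of_sum_mul (IsCochain.polynomial (V := trivialModule A) γ.2 a)
    (fun x => ?_) x
  rw [← derFun_trivialModule (A := A)]
  exact congrFun (congrFun (congrArg Subtype.val h) x) a

theorem basicDer_zero : basicDer (trivialModule A) 0 = 0 :=
  LinearMap.ext fun γ => Subtype.ext (funext fun x => funext fun a => by
    change derFun (trivialModule A) γ.1 x a = 0
    rw [derFun_trivialModule]; simp)

theorem basicD_zero : basicD (trivialModule A) 0 = 0 :=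
  LinearMap.ext fun γ => Subtype.ext (funext fun x => funext fun a => by
    change dFun (trivialModule A) γ.1 x a = 0
    simp [dFun, dAct_trivialModule, dBracket])

/-! ### The differential written out in degrees `1` and `2` -/

theorem dFun_one (γ : (Fin 1 → ℂ) → (Fin 1 → R) → ℂ) (x y : ℂ) (a b : R) :
    dFun (trivialModule A) γ ![x, y] ![a, b] =
      -γ ![x + y] ![PolynomialModule.eval x (A.bracket a b)] := by
  have h : ∀ F : Fin 1 → Fin 1 → ℂ, ∑ i, ∑ j ≥ i, F i j = F 0 0 := fun F => by
    rw [Fin.sum_univ_one, show Finset.Ici (0 : Fin 1) = {0} by decide, Finset.sum_singleton]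
  rw [dFun, dAct_trivialModule, zero_add]
  refine (h _).trans ?_
  change (-1 : ℂ) ^ 3 • γ (Fin.cons (x + y) _)
    (Fin.cons (PolynomialModule.eval x (A.bracket a b)) _) = _
  rw [show (-1 : ℂ) ^ 3 = -1 by norm_num, neg_smul, one_smul]
  refine congrArg Neg.neg (congrArg₂ γ ?_ ?_) <;> (ext k; fin_cases k; rfl)

theorem removeNth_zero_zero {α : Type*} (u v w : α) :
    (0 : Fin 2).removeNth ((0 : Fin 3).removeNth ![u, v, w]) = ![w] := by
  ext k; fin_cases k; rfl

theorem removeNth_one_zero {α : Type*} (u v w : α) :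
    (1 : Fin 2).removeNth ((0 : Fin 3).removeNth ![u, v, w]) = ![v] := by
  ext k; fin_cases k; rfl

theorem removeNth_one_one {α : Type*} (u v w : α) :
    (1 : Fin 2).removeNth ((1 : Fin 3).removeNth ![u, v, w]) = ![u] := by
  ext k; fin_cases k; rfl

theorem dFun_two (γ : (Fin 2 → ℂ) → (Fin 2 → R) → ℂ) (x y z : ℂ) (a b c : R) :
    dFun (trivialModule A) γ ![x, y, z] ![a, b, c] =
      -γ ![x + y, z] ![PolynomialModule.eval x (A.bracket a b), c] +
      γ ![x + z, y] ![PolynomialModule.eval x (A.bracket a c), b] -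
      γ ![y + z, x] ![PolynomialModule.eval y (A.bracket b c), a] := by
  have h : ∀ F : Fin 2 → Fin 2 → ℂ, ∑ i, ∑ j ≥ i, F i j = F 0 0 + F 0 1 + F 1 1 := fun F => by
    rw [Fin.sum_univ_two, show Finset.Ici (0 : Fin 2) = {0, 1} by decide,
      show Finset.Ici (1 : Fin 2) = {1} by decide, Finset.sum_singleton,
      Finset.sum_pair zero_ne_one]
  rw [dFun, dAct_trivialModule, zero_add]
  refine (h _).trans ?_
  change (-1 : ℂ) ^ 3 •
        γ (Fin.cons (x + y) ((0 : Fin 2).removeNth ((0 : Fin 3).removeNth ![x, y, z])))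
          (Fin.cons (PolynomialModule.eval x (A.bracket a b))
            ((0 : Fin 2).removeNth ((0 : Fin 3).removeNth ![a, b, c]))) +
      (-1 : ℂ) ^ 4 •
        γ (Fin.cons (x + z) ((1 : Fin 2).removeNth ((0 : Fin 3).removeNth ![x, y, z])))
          (Fin.cons (PolynomialModule.eval x (A.bracket a c))
            ((1 : Fin 2).removeNth ((0 : Fin 3).removeNth ![a, b, c]))) +
      (-1 : ℂ) ^ 5 •
        γ (Fin.cons (y + z) ((1 : Fin 2).removeNth ((1 : Fin 3).removeNth ![x, y, z])))
          (Fin.cons (PolynomialModule.eval y (A.bracket b c))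
            ((1 : Fin 2).removeNth ((1 : Fin 3).removeNth ![a, b, c]))) = _
  rw [removeNth_zero_zero, removeNth_zero_zero, removeNth_one_zero, removeNth_one_zero,
    removeNth_one_one, removeNth_one_one, show (-1 : ℂ) ^ 3 = -1 by norm_num,
    show (-1 : ℂ) ^ 4 = 1 by norm_num, show (-1 : ℂ) ^ 5 = -1 by norm_num, neg_smul, neg_smul,
    one_smul, one_smul, one_smul, ← sub_eq_add_neg]
  rfl

end Trivial


/-! ### Cochains of the Block type Lie conformal algebra with trivial coefficients -/

/-- A linear form with `f(∂r) = -l f(r)` is determined by its values on the `J_n`. -/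
theorem linearMap_eq_zero {f : Block →ₗ[ℂ] ℂ} {l : ℂ} (hf : ∀ r, f (blockDer r) = -(l * f r))
    (hJ : ∀ n, f (J n) = 0) (r : Block) : f r = 0 := by
  induction r using Finsupp.induction_linear with
  | zero => exact map_zero f
  | add r s hr hs => rw [map_add, hr, hs, add_zero]
  | single n p =>
    induction p using Polynomial.induction_on with
    | C c =>
      have : Finsupp.single n (C c) = c • J n := by simp [J, smul_eq_C_mul]
      rw [this, map_smul, hJ, smul_zero]
    | add p q hp hq => rw [Finsupp.single_add, map_add, hp, hq, add_zero]
    | monomial k c hk =>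
      rw [show C c * X ^ (k + 1) = X * (C c * X ^ k) by ring, ← blockDer_single, hf, hk]
      simp

/-- A cochain vanishes if it vanishes whenever one of the arguments is a `J_n`. -/
theorem IsCochain.eq_zero_of_update {n : ℕ} {γ : (Fin n → ℂ) → (Fin n → Block) → ℂ}
    (h : IsCochain (trivialModule blockB) γ) (x : Fin n → ℂ) (a : Fin n → Block) (i : Fin n)
    (hJ : ∀ k, γ x (Function.update a i (J k)) = 0) : γ x a = 0 := by
  obtain ⟨f, hf⟩ := h.multilinear x
  have key := linearMap_eq_zero (f := f.toLinearMap a i) (l := x i) (fun r => ?_)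
    (fun k => by simp [hf, hJ]) (a i)
  · simpa [hf] using key
  · have := h.antilinear x (Function.update a i r) i
    simpa [hf, blockB] using this

theorem IsCochain.one_eq_zero {γ : (Fin 1 → ℂ) → (Fin 1 → Block) → ℂ}
    (h : IsCochain (trivialModule blockB) γ) {l : ℂ} (hJ : ∀ k, γ ![l] ![J k] = 0)
    (a : Block) : γ ![l] ![a] = 0 :=
  h.eq_zero_of_update _ _ 0 fun k => by
    rw [show Function.update ![a] 0 (J k) = ![J k] by funext i; fin_cases i; rfl, hJ]

theorem IsCochain.two_eq_zero {γ : (Fin 2 → ℂ) → (Fin 2 → Block) → ℂ}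
    (h : IsCochain (trivialModule blockB) γ) {l m : ℂ}
    (hJ : ∀ j k, γ ![l, m] ![J j, J k] = 0) (a b : Block) : γ ![l, m] ![a, b] = 0 :=
  h.eq_zero_of_update _ _ 0 fun j => h.eq_zero_of_update _ _ 1 fun k => by
    rw [show Function.update (Function.update ![a, b] 0 (J j)) 1 (J k) = ![J j, J k] by
      funext i; fin_cases i <;> rfl, hJ]

/-- Antilinearity in the first argument replaces `∂` by `-s` in `(i+1)∂ + (i+j+2)l`. -/
theorem IsCochain.bracket_J {n : ℕ} {γ : (Fin (n + 1) → ℂ) → (Fin (n + 1) → Block) → ℂ}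
    (h : IsCochain (trivialModule blockB) γ) (s l : ℂ) (i j : ℕ) (x : Fin n → ℂ)
    (c : Fin n → Block) :
    γ (Matrix.vecCons s x)
        (Matrix.vecCons (PolynomialModule.eval l (blockB.bracket (J i) (J j))) c) =
      ((i + j + 2) * l - (i + 1) * s) *
        γ (Matrix.vecCons s x) (Matrix.vecCons (J (i + j)) c) := by
  have h1 := antilinear_cons h.isPre s (J (i + j)) x c
  obtain ⟨f, hf⟩ := h.multilinear (Matrix.vecCons s x)
  change γ (Matrix.vecCons s x) (Fin.cons _ c) =
    -(s • γ (Matrix.vecCons s x) (Fin.cons _ c)) at h1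
  change γ (Matrix.vecCons s x) (Fin.cons _ c) = _ * γ (Matrix.vecCons s x) (Fin.cons _ c)
  rw [← hf, ← hf] at h1 ⊢
  rw [blockB_bracket_J, MultilinearMap.cons_add, MultilinearMap.cons_smul,
    MultilinearMap.cons_smul, h1]
  simp only [smul_eq_mul]
  ring

theorem eq_vec_one {α : Type*} (x : Fin 1 → α) : x = ![x 0] := by
  ext k; fin_cases k; rfl

theorem eq_vec_two {α : Type*} (x : Fin 2 → α) : x = ![x 0, x 1] := by
  ext k; fin_cases k <;> rfl

theorem eq_vec_three {α : Type*} (x : Fin 3 → α) : x = ![x 0, x 1, x 2] := by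
  ext k; fin_cases k <;> rfl

/-- A `1`-cochain whose differential vanishes on `λ_1 + λ_2 = 0` is in the image of `∂`. -/
theorem exists_basicDer_eq_one (β : basicCochain (trivialModule blockB) 1)
    (h : ∀ (x : ℂ) (i j : ℕ), (basicD (trivialModule blockB) 1 β).1 ![x, -x] ![J i, J j] = 0) :
    ∃ ω, basicDer (trivialModule blockB) 1 ω = β := by
  have hβ : IsCochain (trivialModule blockB) β.1 := β.2
  refine exists_basicDer_eq β fun x a hx => ?_
  rw [Fin.sum_univ_one] at hx
  rw [eq_vec_one x, eq_vec_one a, hx]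
  refine hβ.one_eq_zero (fun k => ?_) _
  -- On the antidiagonal the bracket is evaluated at `λ = 0`, so the pair `(J_k, J_0)` at `x = 1`
  -- gives `-(k + 2) β_0(J_k) = 0`.
  have h1 := h 1 k 0
  change dFun (trivialModule blockB) β.1 _ _ = 0 at h1
  rw [dFun_one, hβ.bracket_J] at h1
  have h2 : (k : ℂ) + 2 ≠ 0 := by exact_mod_cast (Nat.succ_ne_zero (k + 1))
  simpa [h2] using h1

theorem blockB_act_J_zero (v : ℂ) :
    PolynomialModule.eval 0 ((trivialModule blockB).act (J 0) v) =
      (trivialModule blockB).der v + (0 : ℂ) • v := by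
  simp [scalarModule]

/-- The Cartan formula with constant `0`: on cocycles the term `ιd` drops out. -/
theorem basicDer_eq_of_basicD_eq_zero {n : ℕ} {γ : basicCochain (trivialModule blockB) (n + 1)}
    (h : basicD (trivialModule blockB) (n + 1) γ = 0) :
    basicDer (trivialModule blockB) (n + 1) γ =
      basicD (trivialModule blockB) n (contract (trivialModule blockB) (J 0) n γ) := by
  have h1 := contract_basicD blockB_bracket_J_zero blockB_act_J_zero n γ
  rw [h, zero_smul, add_zero] at h1
  exact (sub_eq_zero.1 (h1.symm.trans rfl))

theorem eq_zero_of_basicD_one {γ : basicCochain (trivialModule blockB) 1}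
    (h : basicD (trivialModule blockB) 1 γ = 0) : γ = 0 := by
  refine basicDer_injective 0 ?_
  rw [basicDer_eq_of_basicD_eq_zero h, basicD_zero, map_zero, LinearMap.zero_apply]

theorem basicDer_apply_of_sum_eq_zero {n : ℕ} (γ : basicCochain (trivialModule blockB) n)
    {x : Fin n → ℂ} (hx : ∑ i, x i = 0) (a : Fin n → Block) :
    (basicDer (trivialModule blockB) n γ).1 x a = 0 := by
  change derFun (trivialModule blockB) γ.1 x a = 0
  rw [derFun_trivialModule, hx, zero_mul]

/-- Since `dιγ = ∂γ` vanishes on `λ_1 + λ_2 = 0`, the contraction is itself some `∂ω`; then `∂γ =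
∂dω`, and `∂` can be cancelled. -/
theorem exists_basicD_eq_of_basicD_two {γ : basicCochain (trivialModule blockB) 2}
    (h : basicD (trivialModule blockB) 2 γ = 0) :
    ∃ β, basicD (trivialModule blockB) 1 β = γ := by
  have h1 := basicDer_eq_of_basicD_eq_zero h
  obtain ⟨ω, hω⟩ := exists_basicDer_eq_one (contract (trivialModule blockB) (J 0) 1 γ)
    fun x i j => by
      rw [← h1]
      exact basicDer_apply_of_sum_eq_zero γ (by simp) _
  refine ⟨ω, basicDer_injective 1 ?_⟩
  rw [h1, ← hω, basicD_basicDer]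

/-! ### Reduced `2`-cocycles -/

theorem polynomial_eq_of_mul {p q : ℂ[X]} (h : ∀ x, x * p.eval x = x * q.eval x) : p = q :=
  mul_left_cancel₀ X_ne_zero (Polynomial.funext fun x => by simpa using h x)

/-- Comparing coefficients, degree `k` survives only if `2 ^ k = 2`. -/
theorem eval_eq_of_eval_two_mul {p : ℂ[X]} (h : ∀ x, x * p.eval (2 * x) = x * (2 * p.eval x))
    (x : ℂ) : p.eval x = p.coeff 1 * x := by
  have h1 : p.comp (C 2 * X) = C 2 * p := polynomial_eq_of_mul fun x => by simpa using h x
  have h2 : p = C (p.coeff 1) * X := by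
    ext k
    have h3 := congrArg (fun q => q.coeff k) h1
    simp only [comp_C_mul_X_coeff, coeff_C_mul] at h3
    rcases eq_or_ne k 1 with rfl | hk
    · simp
    · rw [coeff_C_mul, coeff_X, if_neg hk.symm, mul_zero]
      have h4 : (2 : ℂ) ^ k ≠ 2 := by
        intro h5
        have : (2 : ℕ) ^ k = 2 ^ 1 := by exact_mod_cast h5
        exact hk (Nat.pow_right_injective le_rfl this)
      have h6 : (2 ^ k - 2) * p.coeff k = 0 := by linear_combination h3
      exact (mul_eq_zero.1 h6).resolve_left (sub_ne_zero.2 h4)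
  conv_lhs => rw [h2]
  simp

/-- Equality does hold for `k = 1` and `k = 3`. From `k = 4` on, `3 ^ k` alone exceeds `4 * 2 ^ k`.
-/
theorem three_pow_ne {k : ℕ} (h1 : k ≠ 1) (h3 : k ≠ 3) : 3 ^ k + 5 ≠ 4 * 2 ^ k := by
  rcases lt_or_ge k 4 with h | h
  · interval_cases k <;> simp_all
  · obtain ⟨m, rfl⟩ := Nat.exists_eq_add_of_le h
    have : 2 ^ m ≤ 3 ^ m := Nat.pow_le_pow_left (by norm_num) m
    rw [pow_add, pow_add]
    omega

/-- Degree `k` survives only if `3 ^ k = 4 * 2 ^ k - 5`, that is for `k = 1` and `k = 3`. The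
exponent `3` is the source of the Virasoro cocycle. -/
theorem eval_eq_of_eval_three_mul {p : ℂ[X]}
    (h : ∀ x, x * p.eval (3 * x) = x * (4 * p.eval (2 * x) - 5 * p.eval x)) (x : ℂ) :
    p.eval x = p.coeff 1 * x + p.coeff 3 * x ^ 3 := by
  have h1 : p.comp (C 3 * X) = C 4 * p.comp (C 2 * X) - C 5 * p :=
    polynomial_eq_of_mul fun x => by simpa using h x
  have h2 : p = C (p.coeff 1) * X + C (p.coeff 3) * X ^ 3 := by
    ext k
    have h3 := congrArg (fun q => q.coeff k) h1
    simp only [comp_C_mul_X_coeff, coeff_C_mul, coeff_sub] at h3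
    rcases eq_or_ne k 1 with rfl | hk
    · simp [coeff_X_pow]
    rcases eq_or_ne k 3 with rfl | hk'
    · simp
    · rw [coeff_add, coeff_C_mul, coeff_C_mul, coeff_X, if_neg hk.symm, coeff_X_pow, if_neg hk',
        mul_zero, mul_zero, add_zero]
      have h4 : (3 : ℂ) ^ k + 5 ≠ 4 * 2 ^ k := by exact_mod_cast three_pow_ne hk hk'
      have h6 : (3 ^ k + 5 - 4 * 2 ^ k) * p.coeff k = 0 := by linear_combination h3
      exact (mul_eq_zero.1 h6).resolve_left (sub_ne_zero.2 h4)
  conv_lhs => rw [h2]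
  simp

/-- The values `F_{ij}(λ) = γ_{λ,-λ}(J_i, J_j)` of a reduced `2`-cocycle. -/
theorem reduced_two_cocycle {F : ℕ → ℕ → ℂ[X]}
    (hs : ∀ i j x, (F j i).eval (-x) = -(F i j).eval x)
    (hF : ∀ (i j : ℕ) (x y : ℂ), ((j + 1) * x - (i + 1) * y) * (F (i + j) 0).eval (x + y) =
      ((i + 2) * x + (i + 1) * y) * (F i j).eval (-y) +
        ((j + 2) * y + (j + 1) * x) * (F i j).eval x) :
    ∃ (c : ℕ → ℂ) (e : ℂ), ∀ i j x,
      (F i j).eval x = c (i + j) * x + if (i, j) = (0, 0) then e * x ^ 3 else 0 := by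
  -- This is the functional equation at `y = 0`, divided by `x`.
  have h1 : ∀ i j : ℕ, C ((j : ℂ) + 1) * F (i + j) 0 =
      C (((i : ℂ) + 2) * (F i j).eval 0) + C ((j : ℂ) + 1) * F i j := by
    intro i j
    refine polynomial_eq_of_mul fun x => ?_
    have := hF i j x 0
    simp only [add_zero, neg_zero] at this
    simp only [eval_add, eval_mul, eval_C]
    linear_combination this
  have h1' : ∀ (i j : ℕ) x, ((j : ℂ) + 1) * (F (i + j) 0).eval x =
      ((i : ℂ) + 2) * (F i j).eval 0 + ((j : ℂ) + 1) * (F i j).eval x := fun i j x => by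
    simpa using congrArg (eval x) (h1 i j)
  -- The pair `(0, n)` at `x = 0`, together with `F_{0n}(0) = -F_{n0}(0)`, gives `(2n + 4) F_{n0}(0)
  -- = 0`.
  have h2 : ∀ n, (F n 0).eval 0 = 0 := by
    intro n
    have e1 := h1' 0 n 0
    have e2 := hs n 0 0
    rw [neg_zero] at e2
    rw [zero_add, e2] at e1
    have h3 : (2 * (n : ℂ) + 4) ≠ 0 := by
      exact_mod_cast (Nat.succ_ne_zero (2 * n + 3))
    refine (mul_eq_zero.1 (?_ : (2 * (n : ℂ) + 4) * _ = 0)).resolve_left h3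
    push_cast at e1
    linear_combination e1
  have h3 : ∀ i j, (F i j).eval 0 = 0 := by
    intro i j
    have e1 := h1' i j 0
    rw [h2] at e1
    have h4 : ((i : ℂ) + j + 3) ≠ 0 := by
      exact_mod_cast (Nat.succ_ne_zero (i + j + 2))
    refine (mul_eq_zero.1 (?_ : ((i : ℂ) + j + 3) * _ = 0)).resolve_left h4
    linear_combination -e1
  -- With the constant terms gone, `F_ij` depends only on `i + j`; skew-symmetry then makes it odd.
  have h5 : ∀ i j x, (F i j).eval x = (F (i + j) 0).eval x := by
    intro i j x
    have e1 := h1' i j x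
    rw [h3] at e1
    have h4 : ((j : ℂ) + 1) ≠ 0 := Nat.cast_add_one_ne_zero j
    refine mul_left_cancel₀ h4 ?_
    linear_combination -e1
  have h6 : ∀ n x, (F n 0).eval (-x) = -(F n 0).eval x := by
    intro n x
    rw [hs 0 n, h5 0 n, zero_add]
  have h7 : ∀ (n : ℕ) (x y : ℂ), (x - (n + 1) * y) * (F n 0).eval (x + y) =
      -((n + 2) * x + (n + 1) * y) * (F n 0).eval y + (2 * y + x) * (F n 0).eval x := by
    intro n x y
    have := hF n 0 x y
    rw [h6, add_zero n] at this
    push_cast at this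
    linear_combination this
  refine ⟨fun n => (F n 0).coeff 1, (F 0 0).coeff 3, fun i j x => ?_⟩
  rw [h5]
  rcases Nat.eq_zero_or_pos (i + j) with h | h
  · obtain ⟨rfl, rfl⟩ := Nat.add_eq_zero_iff.1 h
    simp only [if_true]
    refine eval_eq_of_eval_three_mul (fun x => ?_) x
    -- For `n = 0` the choice `y = x` is vacuous, so `y = 2x` is used: `F(3x) = 4F(2x) - 5F(x)`, up
    -- to the factor `x`.
    have := h7 0 x (2 * x)
    rw [show x + 2 * x = 3 * x by ring] at this
    push_cast at this
    linear_combination -this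
  · have hij : (i, j) ≠ (0, 0) := by
      rintro h0
      simp only [Prod.mk.injEq] at h0
      omega
    rw [if_neg hij, add_zero]
    refine eval_eq_of_eval_two_mul (fun x => ?_) x
    -- For `n > 0`, `y = x` gives `n x F(2x) = 2 n x F(x)`, which excludes the cubic term.
    have := h7 (i + j) x x
    rw [show x + x = 2 * x by ring] at this
    have h8 : (((i + j : ℕ) : ℂ)) ≠ 0 := by exact_mod_cast h.ne'
    refine mul_left_cancel₀ h8 ?_
    linear_combination -this

/-- Restricting a polynomial in two variables to the line `(x, -x)` gives a polynomial in one
variable. -/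
theorem IsCochain.exists_eval_eq {γ : (Fin 2 → ℂ) → (Fin 2 → Block) → ℂ}
    (h : IsCochain (trivialModule blockB) γ) (a : Fin 2 → Block) :
    ∃ p : ℂ[X], ∀ x, γ ![x, -x] a = p.eval x := by
  obtain ⟨p, hp⟩ := mem_polyFun_complex (h.polynomial a)
  refine ⟨MvPolynomial.aeval ![X, -X] p, fun x => ?_⟩
  rw [hp, ← Polynomial.coe_evalRingHom, MvPolynomial.aeval_def, MvPolynomial.hom_eval₂,
    MvPolynomial.eval, MvPolynomial.coe_eval₂Hom]
  congr 1
  · ext c; simp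
  · ext k; fin_cases k <;> simp

theorem exists_of_reduced_two_cocycle {γ : basicCochain (trivialModule blockB) 2}
    (h : ∀ x y a, (basicD (trivialModule blockB) 2 γ).1 ![x, y, -(x + y)] a = 0) :
    ∃ (c : ℕ → ℂ) (e : ℂ), ∀ (i j : ℕ) (x : ℂ),
      γ.1 ![x, -x] ![J i, J j] = c (i + j) * x + if (i, j) = (0, 0) then e * x ^ 3 else 0 := by
  have hγ : IsCochain (trivialModule blockB) γ.1 := γ.2
  choose F hF using fun i j => hγ.exists_eval_eq ![J i, J j]
  have hs : ∀ i j x, (F j i).eval (-x) = -(F i j).eval x := by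
    intro i j x
    rw [← hF, ← hF, neg_neg]
    exact hγ.swap _ _ _ _ _ _
  have hE : ∀ (i j : ℕ) (x y : ℂ),
      ((j + 1) * x - (i + 1) * y) * (F (i + j) 0).eval (x + y) =
        ((i + 2) * x + (i + 1) * y) * (F i j).eval (-y) +
          ((j + 2) * y + (j + 1) * x) * (F i j).eval x := by
    intro i j x y
    -- Triples ending in `J_0` suffice: they already relate every `F_ij` to `F_{i+j,0}`.
    have h1 := h x y ![J i, J j, J 0]
    change dFun (trivialModule blockB) γ.1 _ _ = 0 at h1
    rw [dFun_two, hγ.bracket_J, hγ.bracket_J, hγ.bracket_J, hF,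
      show x + -(x + y) = -y by ring, show y + -(x + y) = -x by ring] at h1
    have h2 := hF i j (-y)
    have h3 := hF j i (-x)
    rw [neg_neg] at h2 h3
    rw [add_zero i, add_zero j, h2, h3, hs i j x] at h1
    push_cast at h1
    linear_combination -h1
  obtain ⟨c, e, hc⟩ := reduced_two_cocycle hs hE
  exact ⟨c, e, fun i j x => by rw [hF, hc]⟩


/-! ### Explicit cochains and the cohomology in low degrees -/

/-- The coefficient of `J_n` evaluated at `∂ = -l`. -/
def coeffAt (n : ℕ) (l : ℂ) : Block →ₗ[ℂ] ℂ :=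
  Polynomial.leval (-l) ∘ₗ Finsupp.lapply n

theorem coeffAt_apply (n : ℕ) (l : ℂ) (a : Block) : coeffAt n l a = (a n).eval (-l) := rfl

theorem coeffAt_blockDer (n : ℕ) (l : ℂ) (a : Block) :
    coeffAt n l (blockDer a) = -(l * coeffAt n l a) := by
  simp [coeffAt_apply, blockDer]

theorem coeffAt_J (n k : ℕ) (l : ℂ) : coeffAt n l (J k) = if k = n then 1 else 0 := by
  simp only [coeffAt_apply, J, Finsupp.single_apply]
  split_ifs <;> simp

theorem coeffAt_eq_eval {m : ℕ} (n : ℕ) (x : Fin m → ℂ) (i : Fin m) (a : Block) :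
    coeffAt n (x i) a = MvPolynomial.eval x (aeval (-MvPolynomial.X i) (a n)) := by
  rw [coeffAt_apply, ← MvPolynomial.coe_aeval_eq_eval, AlgHom.coe_toRingHom,
    ← Polynomial.aeval_algHom_apply]
  simp [Polynomial.aeval_def, Polynomial.eval₂_eq_eval_map]

/-- The cochain on the multiples of `J_0` given by an alternating polynomial. -/
def virCochain {n : ℕ} (p : MvPolynomial (Fin n) ℂ)
    (hp : ∀ (x : Fin n → ℂ) (σ : Equiv.Perm (Fin n)), MvPolynomial.eval (x ∘ σ) p =
      ((Equiv.Perm.sign σ : ℤ) : ℂ) * MvPolynomial.eval x p) :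
    basicCochain (trivialModule blockB) n :=
  ⟨fun x a => MvPolynomial.eval x p * ∏ i, coeffAt 0 (x i) (a i), by
    refine ⟨fun x => ?_, fun a => ?_, fun x a i => ?_, fun x a σ => ?_⟩
    · exact ⟨MvPolynomial.eval x p • (MultilinearMap.mkPiAlgebra ℂ (Fin n) ℂ).compLinearMap
        fun i => coeffAt 0 (x i), fun a => by simp⟩
    · have := eval_mem_polyFun (p * ∏ i, aeval (-MvPolynomial.X i) (a i 0))
      simpa [coeffAt_eq_eval] using this
    · have : ∀ u : Block, ∏ k, coeffAt 0 (x k) (Function.update a i u k) =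
          coeffAt 0 (x i) u * ∏ k ∈ Finset.univ.erase i, coeffAt 0 (x k) (a k) := by
        intro u
        rw [← Finset.mul_prod_erase _ _ (Finset.mem_univ i), Function.update_self]
        congr 1
        refine Finset.prod_congr rfl fun k hk => ?_
        rw [Function.update_of_ne (Finset.ne_of_mem_erase hk)]
      have h2 := this (a i)
      rw [Function.update_eq_self] at h2
      rw [this, h2, show blockB.der = blockDer from rfl, coeffAt_blockDer, smul_eq_mul]
      ring
    · have : ∏ i, coeffAt 0 ((x ∘ σ) i) ((a ∘ σ) i) = ∏ i, coeffAt 0 (x i) (a i) :=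
        Equiv.prod_comp σ fun i => coeffAt 0 (x i) (a i)
      rw [hp, this, smul_eq_mul, mul_assoc]⟩

/-- The `1`-cochain with value `c_n` on `J_n`. -/
def oneCochain (c : ℕ → ℂ) : basicCochain (trivialModule blockB) 1 :=
  ⟨fun x a => Finsupp.lsum ℂ (fun n => c n • Polynomial.leval (-(x 0))) (a 0), by
    have key : ∀ (l : ℂ) (a : Block),
        Finsupp.lsum ℂ (fun n => c n • Polynomial.leval (-l)) a =
          ∑ n ∈ a.support, c n * coeffAt n l a := fun l a => by
      simp [Finsupp.sum, coeffAt_apply]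
    refine ⟨fun x => ?_, fun a => ?_, fun x a i => ?_, fun x a σ => ?_⟩
    · exact ⟨LinearMap.compMultilinearMap (Finsupp.lsum ℂ fun n => c n • Polynomial.leval (-(x 0)))
        (MultilinearMap.ofSubsingleton ℂ Block Block (0 : Fin 1) LinearMap.id), fun a => by simp⟩
    · have := eval_mem_polyFun (∑ n ∈ (a 0).support,
        MvPolynomial.C (c n) * aeval (-MvPolynomial.X (0 : Fin 1)) (a 0 n))
      simpa [key, coeffAt_eq_eval] using this
    · obtain rfl : i = 0 := Subsingleton.elim _ _
      simp only [Function.update_self]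
      induction a 0 using Finsupp.induction_linear with
      | zero => simp
      | add a b ha hb => simp only [map_add, ha, hb, smul_add]; ring
      | single n f =>
        simp only [show blockB.der = blockDer from rfl, blockDer_single, Finsupp.lsum_single,
          LinearMap.smul_apply, leval_apply, eval_mul, eval_X, smul_eq_mul]
        ring
    · obtain rfl : σ = 1 := Subsingleton.elim _ _
      simp⟩

theorem oneCochain_J (c : ℕ → ℂ) (l : ℂ) (n : ℕ) : (oneCochain c).1 ![l] ![J n] = c n := by
  simp [oneCochain, J]

theorem eval_two_perm (x : Fin 2 → ℂ) (σ : Equiv.Perm (Fin 2)) :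
    MvPolynomial.eval (x ∘ σ)
        (MvPolynomial.C (1 / 2) * (MvPolynomial.X 0 ^ 3 - MvPolynomial.X 1 ^ 3)) =
      ((Equiv.Perm.sign σ : ℤ) : ℂ) * MvPolynomial.eval x
        (MvPolynomial.C (1 / 2) * (MvPolynomial.X 0 ^ 3 - MvPolynomial.X 1 ^ 3)) := by
  have h : ∀ τ : Equiv.Perm (Fin 2), τ = 1 ∨ τ = Equiv.swap 0 1 := by decide
  rcases h σ with rfl | rfl
  · simp
  · simp; ring

/-- The Virasoro cocycle `(λ_1³ - λ_2³)/2` on `J_0`. -/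
def virCocycle : basicCochain (trivialModule blockB) 2 :=
  virCochain (MvPolynomial.C (1 / 2) * (MvPolynomial.X 0 ^ 3 - MvPolynomial.X 1 ^ 3))
    eval_two_perm

theorem virCocycle_apply (x y : ℂ) (a b : Block) :
    virCocycle.1 ![x, y] ![a, b] =
      1 / 2 * (x ^ 3 - y ^ 3) * (coeffAt 0 x a * coeffAt 0 y b) := by
  simp [virCocycle, virCochain, Fin.prod_univ_two]

theorem virCocycle_J (i j : ℕ) (x : ℂ) :
    virCocycle.1 ![x, -x] ![J i, J j] = if (i, j) = (0, 0) then x ^ 3 else 0 := by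
  rw [virCocycle_apply, coeffAt_J, coeffAt_J]
  rcases eq_or_ne i 0 with rfl | hi <;> rcases eq_or_ne j 0 with rfl | hj <;> simp_all
  ring

/-- Indices add under the bracket, so only the `J_0` components contribute. At `∂ = -(x + y)` the
factor `∂ + 2x` becomes `x - y`, and `∂ + x` becomes `-y`. -/
theorem coeffAt_bracket (x y : ℂ) (a b : Block) :
    coeffAt 0 (x + y) (PolynomialModule.eval x (blockB.bracket a b)) =
      (x - y) * (coeffAt 0 x a * coeffAt 0 y b) := by
  simp only [coeffAt_apply, blockB, eval_blockBracket_zero]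
  simp
  ring

/-- When `x + y + z = 0` the differential is a multiple of `x³(y - z) + y³(z - x) + z³(x - y)`, a
polynomial divisible by `x + y + z`. -/
theorem exists_basicDer_eq_basicD_virCocycle :
    ∃ ω, basicDer (trivialModule blockB) 3 ω = basicD (trivialModule blockB) 2 virCocycle := by
  refine exists_basicDer_eq _ fun x a hx => ?_
  change dFun (trivialModule blockB) virCocycle.1 x a = 0
  rw [eq_vec_three x, eq_vec_three a, dFun_two]
  simp only [virCocycle_apply, coeffAt_bracket]
  rw [Fin.sum_univ_three] at hx
  rw [show x 2 = -(x 0 + x 1) by linear_combination hx]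
  ring

/-- On the antidiagonal only the values of `β` at `λ = 0` enter, so a coboundary is linear in `x`
there. This both absorbs the linear terms of a cocycle and separates the cubic one. -/
theorem basicD_one_J (β : basicCochain (trivialModule blockB) 1) (x : ℂ) (i j : ℕ) :
    (basicD (trivialModule blockB) 1 β).1 ![x, -x] ![J i, J j] =
      -((i + j + 2) * x) * β.1 ![0] ![J (i + j)] := by
  have hβ : IsCochain (trivialModule blockB) β.1 := β.2
  change dFun (trivialModule blockB) β.1 _ _ = _
  rw [dFun_one, hβ.bracket_J, add_neg_cancel]
  simp

/-- The `0`-cochain `1`. -/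
def oneZeroCochain : basicCochain (trivialModule blockB) 0 :=
  virCochain (MvPolynomial.C 1) (by simp [Subsingleton.elim _ (1 : Equiv.Perm (Fin 0))])

theorem oneZeroCochain_ne_zero : oneZeroCochain ≠ 0 := by
  intro h
  have := congrFun (congrFun (congrArg Subtype.val h) ![]) ![]
  simp [oneZeroCochain, virCochain] at this

theorem exists_smul_oneZeroCochain (w : basicCochain (trivialModule blockB) 0) :
    ∃ c : ℂ, w = c • oneZeroCochain := by
  refine ⟨w.1 ![] ![], Subtype.ext (funext fun x => funext fun a => ?_)⟩
  rw [Subsingleton.elim x ![], Subsingleton.elim a ![]]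
  simp [oneZeroCochain, virCochain]

/-! ### Dimensions in degrees `0`, `1`, `2` -/

theorem rank_basicCohomology_zero :
    Module.rank ℂ (BasicCohomology (trivialModule blockB) 0) = 1 := by
  refine (rank_cohomology_eq_one _ 0 oneZeroCochain ?_ oneZeroCochain_ne_zero
    fun w _ => ?_).1
  · rw [basicD_zero, LinearMap.zero_apply]
  · obtain ⟨c, rfl⟩ := exists_smul_oneZeroCochain w
    exact ⟨c, sub_self _⟩

theorem rank_basicCohomology_one :
    Module.rank ℂ (BasicCohomology (trivialModule blockB) 1) = 0 :=
  rank_cohomology_eq_zero _ 1 fun z hz => by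
    rw [eq_zero_of_basicD_one hz]
    exact Submodule.zero_mem _

theorem rank_basicCohomology_two :
    Module.rank ℂ (BasicCohomology (trivialModule blockB) 2) = 0 :=
  rank_cohomology_eq_zero _ 2 fun _ hz => exists_basicD_eq_of_basicD_two hz

theorem rank_reducedCohomology_zero :
    Module.rank ℂ (ReducedCohomology (trivialModule blockB) 0) = 1 := by
  refine (rank_cohomology_eq_one _ 0 (Submodule.Quotient.mk oneZeroCochain) ?_ ?_
    fun w _ => ?_).1
  · rw [reducedD_mk, basicD_zero, LinearMap.zero_apply, Submodule.Quotient.mk_zero]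
  · change ¬(_ = (0 : ReducedCochain (trivialModule blockB) 0))
    rw [Submodule.Quotient.mk_eq_zero, basicDer_zero, LinearMap.range_zero, Submodule.mem_bot]
    exact oneZeroCochain_ne_zero
  · obtain ⟨w, rfl⟩ := Submodule.Quotient.mk_surjective _ w
    obtain ⟨c, rfl⟩ := exists_smul_oneZeroCochain w
    exact ⟨c, sub_self _⟩

theorem rank_reducedCohomology_one :
    Module.rank ℂ (ReducedCohomology (trivialModule blockB) 1) = 0 := by
  refine rank_cohomology_eq_zero _ 1 fun z hz => ?_
  obtain ⟨γ, rfl⟩ := Submodule.Quotient.mk_surjective _ z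
  obtain ⟨ω, hω⟩ := (reducedD_mk_eq_zero _ 1 γ).1 hz
  have h : (Submodule.Quotient.mk γ : ReducedCochain (trivialModule blockB) 1) = 0 := by
    rw [Submodule.Quotient.mk_eq_zero]
    refine exists_basicDer_eq_one γ fun x i j => ?_
    rw [← hω]
    exact basicDer_apply_of_sum_eq_zero ω (by simp) _
  rw [h]
  exact Submodule.zero_mem _

theorem reducedD_virCocycle :
    reducedD (trivialModule blockB) 2 (Submodule.Quotient.mk virCocycle) = 0 :=
  (reducedD_mk_eq_zero _ 2 _).2 exists_basicDer_eq_basicD_virCocycle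

theorem mk_virCocycle_notMem_range :
    (Submodule.Quotient.mk virCocycle : ReducedCochain (trivialModule blockB) 2) ∉
      LinearMap.range (reducedD (trivialModule blockB) 1) := by
  rintro ⟨β, hβ⟩
  obtain ⟨β, rfl⟩ := Submodule.Quotient.mk_surjective _ β
  rw [reducedD_mk, Submodule.Quotient.eq] at hβ
  obtain ⟨ω, hω⟩ := hβ
  -- If the class were a coboundary, `x³` would be linear in `x`; the points `1` and `2` refute
  -- this.
  have key : ∀ x : ℂ, -(2 * x) * β.1 ![0] ![J 0] - x ^ 3 = 0 := by
    intro x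
    have h1 := basicDer_apply_of_sum_eq_zero ω (x := ![x, -x]) (by simp) ![J 0, J 0]
    have h2 := basicD_one_J β x 0 0
    have h3 := virCocycle_J 0 0 x
    rw [hω] at h1
    change (basicD (trivialModule blockB) 1 β).1 ![x, -x] ![J 0, J 0] -
      virCocycle.1 ![x, -x] ![J 0, J 0] = 0 at h1
    rw [h2, h3] at h1
    simpa using h1
  have h1 := key 1
  have h2 := key 2
  have : (6 : ℂ) = 0 := by linear_combination 2 * h1 - h2
  norm_num at this

theorem exists_sub_smul_virCocycle_mem (w : ReducedCochain (trivialModule blockB) 2)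
    (hw : reducedD (trivialModule blockB) 2 w = 0) :
    ∃ e : ℂ, w - e • Submodule.Quotient.mk virCocycle ∈
      LinearMap.range (reducedD (trivialModule blockB) 1) := by
  obtain ⟨γ, rfl⟩ := Submodule.Quotient.mk_surjective _ w
  obtain ⟨ω, hω⟩ := (reducedD_mk_eq_zero _ 2 γ).1 hw
  obtain ⟨c, e, hc⟩ := exists_of_reduced_two_cocycle (γ := γ) fun x y a => by
    rw [← hω]
    exact basicDer_apply_of_sum_eq_zero ω (by simp [Fin.sum_univ_succ]) _
  -- On the antidiagonal `dβ` is `-(n + 2) x β_0(J_n)` with `n = i + j`, so this value produces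
  -- exactly the linear term `c n * x`.
  let β := oneCochain fun n => -c n / (n + 2)
  let δ := basicD (trivialModule blockB) 1 β - (γ - e • virCocycle)
  have hδ : IsCochain (trivialModule blockB) δ.1 := δ.2
  refine ⟨e, Submodule.Quotient.mk β, ?_⟩
  rw [reducedD_mk, ← Submodule.Quotient.mk_smul, ← Submodule.Quotient.mk_sub,
    Submodule.Quotient.eq]
  refine exists_basicDer_eq δ fun x a hx => ?_
  rw [Fin.sum_univ_two] at hx
  rw [eq_vec_two x, eq_vec_two a, show x 1 = -x 0 by linear_combination hx]
  refine hδ.two_eq_zero (fun i j => ?_) _ _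
  change (basicD (trivialModule blockB) 1 β).1 ![x 0, -x 0] ![J i, J j] -
    (γ.1 ![x 0, -x 0] ![J i, J j] - e * virCocycle.1 ![x 0, -x 0] ![J i, J j]) = 0
  rw [basicD_one_J, oneCochain_J, hc, virCocycle_J]
  have h2 : (i : ℂ) + j + 2 ≠ 0 := by exact_mod_cast (Nat.succ_ne_zero (i + j + 1))
  push_cast
  split_ifs <;> field_simp <;> ring

theorem rank_reducedCohomology_two :
    Module.rank ℂ (ReducedCohomology (trivialModule blockB) 2) = 1 ∧
      Submodule.span ℂ {(Submodule.Quotient.mk ⟨Submodule.Quotient.mk virCocycle,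
        reducedD_virCocycle⟩ : ReducedCohomology (trivialModule blockB) 2)} = ⊤ :=
  rank_cohomology_eq_one (C := fun k => ReducedCochain (trivialModule blockB) k) _ 2
    (Submodule.Quotient.mk virCocycle) reducedD_virCocycle mk_virCocycle_notMem_range
    exists_sub_smul_virCocycle_mem

end LieConf

end

theorem mainTheorem1 :
    -- (1) the basic cohomology with trivial coefficients has dimensions `1, 0, 0`
    (Module.rank ℂ (LieConf.BasicCohomology (LieConf.trivialModule LieConf.blockB) 0) = 1 ∧
      Module.rank ℂ (LieConf.BasicCohomology (LieConf.trivialModule LieConf.blockB) 1) = 0 ∧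
      Module.rank ℂ (LieConf.BasicCohomology (LieConf.trivialModule LieConf.blockB) 2) = 0) ∧
    -- and the reduced cohomology with trivial coefficients has dimensions `1, 0, 1`
    (Module.rank ℂ (LieConf.ReducedCohomology (LieConf.trivialModule LieConf.blockB) 0) = 1 ∧
      Module.rank ℂ (LieConf.ReducedCohomology (LieConf.trivialModule LieConf.blockB) 1) = 0 ∧
      Module.rank ℂ (LieConf.ReducedCohomology (LieConf.trivialModule LieConf.blockB) 2) = 1) ∧
    -- the reduced cohomology in degree `2` is spanned by the class of a cochain `ψ` with
    -- `ψ_{λ,-λ}(J_0, J_0) = λ³` and `ψ_{λ,-λ}(J_i, J_j) = 0` for `(i, j) ≠ (0, 0)`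
    (∃ ψ : LieConf.basicCochain (LieConf.trivialModule LieConf.blockB) 2,
      (∀ l : ℂ, ψ.1 ![l, -l] ![LieConf.J 0, LieConf.J 0] = l ^ 3) ∧
      (∀ (i j : ℕ) (l : ℂ), (i, j) ≠ (0, 0) → ψ.1 ![l, -l] ![LieConf.J i, LieConf.J j] = 0) ∧
      ∃ h : Submodule.Quotient.mk ψ ∈
          LinearMap.ker (LieConf.reducedD (LieConf.trivialModule LieConf.blockB) 2),
        Submodule.span ℂ {(Submodule.Quotient.mk ⟨Submodule.Quotient.mk ψ, h⟩ :
          LieConf.ReducedCohomology (LieConf.trivialModule LieConf.blockB) 2)} = ⊤) ∧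
    -- (2)
    (∀ a : ℂ, a ≠ 0 → ∀ q : ℕ,
      Module.rank ℂ (LieConf.ReducedCohomology (LieConf.scalarModule LieConf.blockB a) q) = 0) ∧
    -- (3)
    (∀ Δ α : ℂ, α ≠ 0 → ∀ q : ℕ,
      Module.rank ℂ (LieConf.ReducedCohomology (LieConf.rankOneModule Δ α) q) = 0) :=
  ⟨⟨LieConf.rank_basicCohomology_zero, LieConf.rank_basicCohomology_one,
      LieConf.rank_basicCohomology_two⟩,
    ⟨LieConf.rank_reducedCohomology_zero, LieConf.rank_reducedCohomology_one,
      LieConf.rank_reducedCohomology_two.1⟩,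
    ⟨LieConf.virCocycle, fun l => by simpa using LieConf.virCocycle_J 0 0 l,
      fun i j l h => by rw [LieConf.virCocycle_J, if_neg h], LieConf.reducedD_virCocycle,
      LieConf.rank_reducedCohomology_two.2⟩,
    fun _ ha q => LieConf.rank_reducedCohomology_scalarModule ha q,
    fun Δ _ hα q => LieConf.rank_reducedCohomology_rankOneModule Δ hα q⟩
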